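/- Let $\mathcal X$ be a real Hilbert space and let $A\colon D(A)\subset\mathcal X\to\mathcal X$ be a linear maximal monotone operator, i.e. its graph is monotone and is not properly contained in any monotone subset of $\mathcal X\times\mathcal X$. Let $f\in L^\infty_{loc}(\mathbb R_+;\mathcal L(\mathcal X))$, where $\mathcal L(\mathcal X)$ is the space of bounded linear operators on $\mathcal X$ with the operator norm, and let $d\in L^1_{loc}(\mathbb R_+;\mathcal X)$. Consider the problem $$\tfrac{d}{dt}X(t)+AX(t)=f(t)X(t)+d(t),\qquad X(0)=X_0. \tag{P}$$ A mild solution of (P) on $[0,T]$ is a function $X\in C^0([0,T];\mathcal X)$ such that, for all $t\in[0,T]$, $$X(t)=S(t)X_0+\int_0^t S(t-s)\bigl(f(s)X(s)+d(s)\bigr)\,ds,$$ with a Bochner integrable integrand, where $(S(t))_{t\ge0}$ is the strongly continuous semigroup of linear contractions on $\mathcal X$ whose infinitesimal generator is $-A$. Then $\overline{D(A)}=\mathcal X$, and for every $X_0\in\mathcal X$ there is a function $X\colon\mathbb R_+\to\mathcal X$ such that, for every $T>0$, the restriction of $X$ to $[0,T]$ is a mild solution of (P) on $[0,T]$, and it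 is the only one. In particular, the semigroup $(S(t))_{t\ge 0}$ exists. If moreover $f\colon\mathbb R_+\to\mathcal L(\mathcal X)$ and $d\colon\mathbb R_+\to\mathcal X$ are Lipschitz continuous and $X_0\in D(A)$, then for every $T>0$ the solution is classical on $[0,T]$: $X\in C^0([0,T];D(A))\cap C^1([0,T];\mathcal X)$, where $D(A)$ carries the graph norm, $X(0)=X_0$, and $\frac{d}{dt}X(t)+AX(t)=f(t)X(t)+d(t)$ for every $t\in[0,T]$ (with one-sided derivatives at the end points). -/

import Mathlib

open MeasureTheory Set Filter Topology

/-- A subset of `H × H` (the graph of a possibly multivalued operator on `H`) is monotone if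
`⟪y₁ - y₂, x₁ - x₂⟫ ≥ 0` for all `(x₁, y₁)` and `(x₂, y₂)` in it. -/
def IsMonotoneGraph {H : Type*} [NormedAddCommGroup H] [InnerProductSpace ℝ H]
    (G : Set (H × H)) : Prop :=
  ∀ p ∈ G, ∀ q ∈ G, 0 ≤ inner ℝ (p.2 - q.2) (p.1 - q.1)

/-- A linear (unbounded) operator is maximal monotone if its graph is monotone and is not properly
contained in any monotone subset of `H × H`. -/
def IsMaximalMonotone {H : Type*} [NormedAddCommGroup H] [InnerProductSpace ℝ H]
    (A : H →ₗ.[ℝ] H) : Prop :=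
  Maximal IsMonotoneGraph (A.graph : Set (H × H))

/-- `(S t)` for `t ≥ 0` is a strongly continuous semigroup of linear contractions.
The values at negative times play no role. -/
structure IsContractionSemigroup {H : Type*} [NormedAddCommGroup H] [InnerProductSpace ℝ H]
    (S : ℝ → H →L[ℝ] H) : Prop where
  map_zero : S 0 = ContinuousLinearMap.id ℝ H
  map_add : ∀ s t : ℝ, 0 ≤ s → 0 ≤ t → S (s + t) = (S s).comp (S t)
  strongly_continuous : ∀ x : H, ContinuousOn (fun t => S t x) (Ici 0)
  contraction : ∀ t : ℝ, 0 ≤ t → ∀ x y : H, ‖S t x - S t y‖ ≤ ‖x - y‖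

/-- `G` is the infinitesimal generator of `S`: `x ∈ D(G)` and `G x = y` if and only if
`(S h x - x) / h → y` as `h → 0⁺`. -/
def IsInfinitesimalGenerator {H : Type*} [NormedAddCommGroup H] [InnerProductSpace ℝ H]
    (S : ℝ → H →L[ℝ] H) (G : H →ₗ.[ℝ] H) : Prop :=
  ∀ x y : H, (x, y) ∈ G.graph ↔
    Tendsto (fun h : ℝ => h⁻¹ • (S h x - x)) (𝓝[>] 0) (𝓝 y)

/-- `X` is a mild solution on `[0, T]` of `X' + A X = f(t) X + d(t)`, `X(0) = X₀`: it is continuous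
on `[0, T]` and satisfies there the Duhamel formula
`X(t) = S(t) X₀ + ∫₀ᵗ S(t - s) (f(s) X(s) + d(s)) ds` (with a Bochner integrable integrand),
where `S` is the contraction semigroup generated by `-A`. -/
def IsMildSolution {H : Type*} [NormedAddCommGroup H] [InnerProductSpace ℝ H]
    (A : H →ₗ.[ℝ] H) (f : ℝ → H →L[ℝ] H) (d : ℝ → H) (X₀ : H) (T : ℝ) (X : ℝ → H) : Prop :=
  ContinuousOn X (Icc 0 T) ∧
  ∃ S : ℝ → H →L[ℝ] H, IsContractionSemigroup S ∧ IsInfinitesimalGenerator S (-A) ∧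
    ∀ t ∈ Icc (0 : ℝ) T,
      IntervalIntegrable (fun s => S (t - s) (f s (X s) + d s)) volume 0 t ∧
      X t = S t X₀ + ∫ s in (0 : ℝ)..t, S (t - s) (f s (X s) + d s)

/-- `X` is a classical solution on `[0, T]` of `X' + A X = f(t) X + d(t)`, `X(0) = X₀`: it belongs
to `C⁰([0, T]; D(A)) ∩ C¹([0, T]; H)`, where `D(A)` carries the graph norm (so that both `X` and
`A X` are continuous), and the equation holds at every `t ∈ [0, T]`, the derivative being one-sided
at the end points. -/
def IsClassicalSolution {H : Type*} [NormedAddCommGroup H] [InnerProductSpace ℝ H]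
    (A : H →ₗ.[ℝ] H) (f : ℝ → H →L[ℝ] H) (d : ℝ → H) (X₀ : H) (T : ℝ) (X : ℝ → H) : Prop :=
  X 0 = X₀ ∧
  ContDiffOn ℝ 1 X (Icc 0 T) ∧
  ∃ hD : ∀ t : Icc (0 : ℝ) T, X t ∈ A.domain,
    Continuous (fun t : Icc (0 : ℝ) T => (X t, A ⟨X t, hD t⟩)) ∧
    ∀ t : Icc (0 : ℝ) T,
      derivWithin X (Icc 0 T) t + A ⟨X t, hD t⟩ = f t (X t) + d t

/-! Generation follows Hille and Yosida. Maximality makes `1 + l A` bijective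
(`exists_add_smul_eq`), so the resolvents are contractions and the Yosida approximations are
bounded, monotone and mutually commuting. Their exponentials are contractions. Commutation bounds
the distance between two of them at `x` by `t` times the distance of the generators at `x`, so they
converge on the dense domain and hence everywhere. The limit is the semigroup, and maximality of `A`
prevents its generator from being larger than `-A`.

Mild solutions are fixed points of the Duhamel map, which contracts for an exponentially weighted
sup norm on all of `[0, T]`. Grönwall's inequality gives uniqueness, once the semigroup is known to
be determined by its generator.

For regular data, compare `X` with its time shift. The increment starts at size `O(h)` because `X₀ ∈
D(A)`, and Grönwall keeps it there, so `X` and the forcing are Lipschitz. A weak compactness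
argument then puts `X t` in `D(A)` and yields a right derivative at each time. Dividing the shift
estimate by `h` shows that this derivative stays close to semigroup orbits, hence is continuous, and
a continuous right derivative is a derivative. -/

/-! ### Resolvents and Yosida approximations. -/

section Resolvent

variable {H : Type*} [NormedAddCommGroup H] [InnerProductSpace ℝ H] {A : H →ₗ.[ℝ] H}

theorem IsMaximalMonotone.inner_nonneg (hA : IsMaximalMonotone A) {x y : H}
    (h : (x, y) ∈ A.graph) : 0 ≤ inner ℝ y x := by
  simpa using hA.1 (x, y) h 0 A.graph.zero_mem

/-- Adjoining such a point keeps the graph monotone. All later uses of maximality pass through this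
test. -/
theorem IsMaximalMonotone.mem_graph_of_forall (hA : IsMaximalMonotone A) {u v : H}
    (h : ∀ x y, (x, y) ∈ A.graph → 0 ≤ inner ℝ (y - v) (x - u)) : (u, v) ∈ A.graph := by
  have hm : IsMonotoneGraph (insert (u, v) (A.graph : Set (H × H))) := by
    rintro ⟨a, b⟩ hp ⟨a', b'⟩ hq
    rcases hp with hp | hp <;> rcases hq with hq | hq
    · rw [hp, hq]; simp
    · obtain ⟨rfl, rfl⟩ := Prod.mk.inj hp
      have := h _ _ hq
      rw [← neg_sub b', ← neg_sub a', inner_neg_neg]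
      exact this
    · obtain ⟨rfl, rfl⟩ := Prod.mk.inj hq
      exact h _ _ hp
    · exact hA.1 _ hp _ hq
  exact hA.2 hm (subset_insert _ _) (mem_insert _ _)

theorem IsMaximalMonotone.isClosed_graph (hA : IsMaximalMonotone A) :
    IsClosed (A.graph : Set (H × H)) := by
  have : (A.graph : Set (H × H)) =
      ⋂ p ∈ (A.graph : Set (H × H)), {q | 0 ≤ inner ℝ (p.2 - q.2) (p.1 - q.1)} := by
    ext q
    simp only [mem_iInter, mem_ofPred_eq]
    exact ⟨fun hq p hp => hA.1 p hp q hq,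
      fun h => hA.mem_graph_of_forall fun x y hxy => h (x, y) hxy⟩
  rw [this]
  exact isClosed_biInter fun p _ => isClosed_le continuous_const (by fun_prop)

/-- If `x` is orthogonal to the domain, subtracting `x` from `y` does not change `⟪y, z⟫`, so `(0,
x)` is monotonically related to the graph; linearity then gives `x = A 0 = 0`. -/
theorem IsMaximalMonotone.dense_domain [CompleteSpace H] (hA : IsMaximalMonotone A) :
    Dense (A.domain : Set H) := by
  rw [Submodule.dense_iff_topologicalClosure_eq_top,
    Submodule.topologicalClosure_eq_top_iff, Submodule.eq_bot_iff]
  intro x hx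
  have : ((0 : H), x) ∈ A.graph := hA.mem_graph_of_forall fun z y hzy => by
    have h0 : inner ℝ z x = 0 := hx z (LinearPMap.mem_domain_of_mem_graph hzy)
    rw [sub_zero, inner_sub_left, real_inner_comm, real_inner_comm z x, h0, sub_zero,
      real_inner_comm]
    exact hA.inner_nonneg hzy
  exact LinearPMap.graph_fst_eq_zero_snd A this rfl

theorem IsMaximalMonotone.norm_le_norm_add_smul (hA : IsMaximalMonotone A) {l : ℝ} (hl : 0 < l)
    {x y : H} (h : (x, y) ∈ A.graph) : ‖x‖ ≤ ‖x + l • y‖ := by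
  have h0 := hA.inner_nonneg h
  have h1 : ‖x‖ ^ 2 ≤ inner ℝ (x + l • y) x := by
    rw [inner_add_left, real_inner_smul_left, real_inner_self_eq_norm_sq]
    nlinarith
  have h2 := real_inner_le_norm (x + l • y) x
  by_contra! h3
  nlinarith [norm_nonneg (x + l • y)]

/-- Minty's theorem, with a direct proof by linearity. The map `(x, z) ↦ x + l z` is bounded below
on the closed graph, so its range is closed. If `w` is orthogonal to the range, `(l w, w)` is
monotonically related to the graph, so it belongs to it, and orthogonality gives `2 l ‖w‖² = 0`. -/
theorem IsMaximalMonotone.exists_add_smul_eq [CompleteSpace H] (hA : IsMaximalMonotone A)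
    {l : ℝ} (hl : 0 < l) (y : H) : ∃ x z, (x, z) ∈ A.graph ∧ x + l • z = y := by
  let L : A.graph →L[ℝ] H :=
    (ContinuousLinearMap.fst ℝ H H + l • ContinuousLinearMap.snd ℝ H H).comp A.graph.subtypeL
  have hL : ∀ p : A.graph, L p = p.1.1 + l • p.1.2 := fun p => rfl
  have : CompleteSpace A.graph := hA.isClosed_graph.completeSpace_coe
  have hanti : AntilipschitzWith (Real.toNNReal (1 + 2 / l)) L := by
    refine ContinuousLinearMap.antilipschitz_of_bound L fun p => ?_
    have h1 := hA.norm_le_norm_add_smul hl p.2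
    rw [← hL] at h1
    have h2 : ‖l • p.1.2‖ ≤ 2 * ‖L p‖ := by
      have : l • p.1.2 = L p - p.1.1 := by rw [hL]; abel
      rw [this]
      linarith [norm_sub_le (L p) p.1.1]
    rw [norm_smul, Real.norm_of_nonneg hl.le] at h2
    have h3 : ‖p.1.2‖ ≤ 2 / l * ‖L p‖ := by
      rw [div_mul_eq_mul_div, le_div_iff₀ hl]; linarith
    have h4 : 0 ≤ 2 / l * ‖L p‖ := by positivity
    have h5 : 0 ≤ 1 + 2 / l := by positivity
    rw [Real.coe_toNNReal _ h5, add_mul, one_mul]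
    change ‖p.1‖ ≤ _
    rw [Prod.norm_def]
    exact max_le (by linarith) (by linarith [norm_nonneg (L p)])
  have hclosed : IsClosed (L.range : Set H) := by
    rw [LinearMap.coe_range]
    exact hanti.isClosed_range L.uniformContinuous
  have htop : L.range = ⊤ := by
    rw [← hclosed.submodule_topologicalClosure_eq, Submodule.topologicalClosure_eq_top_iff,
      Submodule.eq_bot_iff]
    intro w hw
    have hw' : ∀ x z, (x, z) ∈ A.graph → inner ℝ x w + l * inner ℝ z w = 0 := fun x z hxz => by
      have := hw (L ⟨(x, z), hxz⟩) ⟨_, rfl⟩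
      rwa [hL, inner_add_left, real_inner_smul_left] at this
    have hmem : (l • w, w) ∈ A.graph := hA.mem_graph_of_forall fun x z hxz => by
      have h1 := hw' x z hxz
      have h2 := hA.inner_nonneg hxz
      have h3 : 0 ≤ l * inner ℝ w w := mul_nonneg hl.le real_inner_self_nonneg
      simp only [inner_sub_left, inner_sub_right, real_inner_smul_right]
      rw [real_inner_comm x w]
      linarith
    have := hw' _ _ hmem
    rw [real_inner_smul_left] at this
    have h0 : inner ℝ w w = (0 : ℝ) := by nlinarith
    exact inner_self_eq_zero.1 h0
  obtain ⟨⟨⟨x, z⟩, hp⟩, rfl⟩ : y ∈ L.range := htop ▸ Submodule.mem_top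
  exact ⟨x, z, hp, rfl⟩

/-- The defining properties of the resolvent `(1 + l A)⁻¹`. -/
structure IsResolvent (A : H →ₗ.[ℝ] H) (l : ℝ) (J : H →L[ℝ] H) : Prop where
  apply_add : ∀ x y, (x, y) ∈ A.graph → J (x + l • y) = x
  mem_graph : ∀ y, (J y, l⁻¹ • (y - J y)) ∈ A.graph
  norm_apply_le : ∀ y, ‖J y‖ ≤ ‖y‖

theorem IsMaximalMonotone.exists_isResolvent [CompleteSpace H] (hA : IsMaximalMonotone A)
    {l : ℝ} (hl : 0 < l) : ∃ J, IsResolvent A l J := by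
  choose j k hjk hj using fun y => hA.exists_add_smul_eq hl y
  have huniq : ∀ x y, (x, y) ∈ A.graph → j (x + l • y) = x := fun x y hxy => by
    have hm := A.graph.sub_mem (hjk (x + l • y)) hxy
    have h1 := hA.norm_le_norm_add_smul hl hm
    have h2 : (j (x + l • y) - x) + l • (k (x + l • y) - y) = 0 := by
      rw [smul_sub, ← sub_eq_zero.2 (hj (x + l • y))]; abel
    have h3 : ‖j (x + l • y) - x‖ ≤ 0 := by
      refine h1.trans ?_
      change ‖(j (x + l • y) - x) + l • (k (x + l • y) - y)‖ ≤ 0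
      rw [h2, norm_zero]
    exact sub_eq_zero.1 (norm_le_zero_iff.1 h3)
  let J₀ : H →ₗ[ℝ] H :=
    { toFun := j
      map_add' := fun x y => by
        have : j ((j x + j y) + l • (k x + k y)) = j x + j y :=
          huniq _ _ (A.graph.add_mem (hjk x) (hjk y))
        rw [← this]
        congr 1
        rw [smul_add]
        nth_rw 1 [← hj x, ← hj y]
        abel
      map_smul' := fun c x => by
        have : j (c • j x + l • c • k x) = c • j x := huniq _ _ (A.graph.smul_mem c (hjk x))
        rw [RingHom.id_apply, ← this]
        congr 1
        nth_rw 1 [← hj x]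
        rw [smul_add, smul_comm] }
  have hbound : ∀ y, ‖j y‖ ≤ ‖y‖ := fun y => by
    have := hA.norm_le_norm_add_smul hl (hjk y)
    rwa [hj] at this
  refine ⟨J₀.mkContinuous 1 fun x => (hbound x).trans_eq (one_mul _).symm, huniq, fun y => ?_, hbound⟩
  change (j y, l⁻¹ • (y - j y)) ∈ A.graph
  have : l⁻¹ • (y - j y) = k y := by
    nth_rw 1 [← hj y]
    rw [add_sub_cancel_left, inv_smul_smul₀ hl.ne']
  rw [this]
  exact hjk y

theorem IsResolvent.map_graph {l : ℝ} (hl : 0 < l) {J : H →L[ℝ] H} (hJ : IsResolvent A l J)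
    {x y : H} (h : (x, y) ∈ A.graph) : (J x, J y) ∈ A.graph := by
  have h1 := hJ.mem_graph x
  have h2 := hJ.apply_add x y h
  rw [map_add, map_smul] at h2
  have h3 : l⁻¹ • (x - J x) = J y := by
    rw [inv_smul_eq_iff₀ hl.ne', sub_eq_iff_eq_add', h2]
  rwa [h3] at h1

/-- `J` preserves the graph, so it maps the equation solved by `K y` to the one that characterises
`K (J y)`. -/
theorem IsResolvent.commute {l m : ℝ} (hl : 0 < l) (hm : 0 < m) {J K : H →L[ℝ] H}
    (hJ : IsResolvent A l J) (hK : IsResolvent A m K) : Commute J K := by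
  refine ContinuousLinearMap.ext fun y => ?_
  change J (K y) = K (J y)
  have h1 := hK.apply_add _ _ (hJ.map_graph hl (hK.mem_graph y))
  rw [← map_smul, ← map_add, smul_inv_smul₀ hm.ne', add_sub_cancel] at h1
  exact h1.symm

/-- The Yosida approximation of `A` built from the resolvent `J` with parameter `l`. -/
noncomputable def yosidaApprox (l : ℝ) (J : H →L[ℝ] H) : H →L[ℝ] H :=
  l⁻¹ • (1 - J)

theorem yosidaApprox_apply (l : ℝ) (J : H →L[ℝ] H) (x : H) :
    yosidaApprox l J x = l⁻¹ • (x - J x) := rfl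

theorem IsResolvent.yosidaApprox_commute {l m : ℝ} (hl : 0 < l) (hm : 0 < m) {J K : H →L[ℝ] H}
    (hJ : IsResolvent A l J) (hK : IsResolvent A m K) :
    Commute (yosidaApprox l J) (yosidaApprox m K) := by
  have h : Commute (1 - J) (1 - K) :=
    ((Commute.one_left _).sub_left ((Commute.one_right J).sub_right (hJ.commute hl hm hK)))
  exact (h.smul_left _).smul_right _

theorem IsResolvent.yosidaApprox_inner_nonneg (hA : IsMaximalMonotone A) {l : ℝ} (hl : 0 < l)
    {J : H →L[ℝ] H} (hJ : IsResolvent A l J) (x : H) :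
    0 ≤ inner ℝ (yosidaApprox l J x) x := by
  have h1 := hA.inner_nonneg (hJ.mem_graph x)
  have h2 : x = J x + l • yosidaApprox l J x := by
    rw [yosidaApprox_apply, smul_inv_smul₀ hl.ne', add_sub_cancel]
  nth_rw 2 [h2]
  rw [inner_add_right, real_inner_smul_right]
  have h3 := mul_nonneg hl.le (real_inner_self_nonneg (x := yosidaApprox l J x))
  rw [yosidaApprox_apply] at *
  linarith

/-- On the domain the approximation is the resolvent applied to `A x`; this yields both its bound
and its convergence. -/
theorem IsResolvent.yosidaApprox_eq {l : ℝ} (hl : 0 < l) {J : H →L[ℝ] H}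
    (hJ : IsResolvent A l J) {x y : H} (h : (x, y) ∈ A.graph) : yosidaApprox l J x = J y := by
  have h2 := hJ.apply_add x y h
  rw [map_add, map_smul] at h2
  rw [yosidaApprox_apply, inv_smul_eq_iff₀ hl.ne', sub_eq_iff_eq_add', h2]

theorem IsResolvent.norm_apply_sub_le {l : ℝ} (hl : 0 < l) {J : H →L[ℝ] H}
    (hJ : IsResolvent A l J) {x y : H} (h : (x, y) ∈ A.graph) : ‖J x - x‖ ≤ l * ‖y‖ := by
  have h2 := hJ.apply_add x y h
  rw [map_add, map_smul] at h2
  have h3 : J x - x = -(l • J y) := by rw [eq_neg_iff_add_eq_zero, sub_add_eq_add_sub, h2, sub_self]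
  rw [h3, norm_neg, norm_smul, Real.norm_of_nonneg hl.le]
  exact mul_le_mul_of_nonneg_left (hJ.norm_apply_le y) hl.le

theorem tendsto_resolvent [CompleteSpace H] (hA : IsMaximalMonotone A) {l : ℕ → ℝ}
    (hl : ∀ n, 0 < l n) (hl0 : Tendsto l atTop (𝓝 0)) {J : ℕ → H →L[ℝ] H}
    (hJ : ∀ n, IsResolvent A (l n) (J n)) (x : H) :
    Tendsto (fun n => J n x) atTop (𝓝 x) := by
  rw [Metric.tendsto_atTop]
  intro ε hε
  obtain ⟨z, hz, hxz⟩ := Metric.mem_closure_iff.1 (hA.dense_domain x) (ε / 3) (by positivity)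
  obtain ⟨y, hzy⟩ := LinearPMap.mem_domain_iff.1 hz
  have h0 : Tendsto (fun n => l n * ‖y‖) atTop (𝓝 0) := by simpa using hl0.mul_const ‖y‖
  obtain ⟨N, hN⟩ := eventually_atTop.1 (h0.eventually (gt_mem_nhds (show 0 < ε / 3 by positivity)))
  refine ⟨N, fun n hn => ?_⟩
  have h1 := ((hJ n).norm_apply_sub_le (hl n) hzy).trans_lt (hN n hn)
  have h2 := (hJ n).norm_apply_le (x - z)
  rw [dist_eq_norm] at hxz ⊢
  have h3 : J n x - x = J n (x - z) + (J n z - z) - (x - z) := by rw [map_sub]; abel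
  rw [h3]
  linarith [norm_sub_le (J n (x - z) + (J n z - z)) (x - z), norm_add_le (J n (x - z)) (J n z - z)]

/-- A maximal monotone operator is approximated on its domain by commuting bounded monotone
operators. -/
theorem IsMaximalMonotone.exists_approx [CompleteSpace H] (hA : IsMaximalMonotone A) :
    ∃ B : ℕ → H →L[ℝ] H, (∀ n x, 0 ≤ inner ℝ (B n x) x) ∧ (∀ m n, Commute (B m) (B n)) ∧
      (∀ n x y, (x, y) ∈ A.graph → ‖B n x‖ ≤ ‖y‖) ∧
      ∀ x y, (x, y) ∈ A.graph → Tendsto (fun n => B n x) atTop (𝓝 y) := by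
  have hl : ∀ n : ℕ, 0 < 1 / ((n : ℝ) + 1) := fun n => Nat.one_div_pos_of_nat
  choose J hJ using fun n => hA.exists_isResolvent (hl n)
  refine ⟨fun n => yosidaApprox _ (J n), fun n x => (hJ n).yosidaApprox_inner_nonneg hA (hl n) x,
    fun m n => (hJ m).yosidaApprox_commute (hl m) (hl n) (hJ n), fun n x y h => ?_,
    fun x y h => ?_⟩
  · rw [(hJ n).yosidaApprox_eq (hl n) h]
    exact (hJ n).norm_apply_le y
  · simp_rw [fun n => (hJ n).yosidaApprox_eq (hl n) h]
    exact tendsto_resolvent hA hl tendsto_one_div_add_atTop_nhds_zero_nat hJ y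

end Resolvent

/-! ### Exponentials of bounded monotone operators. -/

section Exponential

variable {H : Type*} [NormedAddCommGroup H] [InnerProductSpace ℝ H]

/-- The uniformly continuous group `exp (-t B)` generated by `-B`. -/
noncomputable def expNeg (B : H →L[ℝ] H) (t : ℝ) : H →L[ℝ] H :=
  NormedSpace.exp (t • (-B))

theorem expNeg_zero (B : H →L[ℝ] H) : expNeg B 0 = 1 := by
  rw [expNeg, zero_smul, NormedSpace.exp_zero]

theorem expNeg_commute {B C : H →L[ℝ] H} (h : Commute B C) (t : ℝ) :
    Commute (expNeg B t) C :=
  ((h.neg_left).smul_left t).exp_left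

theorem expNeg_apply_comm (B : H →L[ℝ] H) (x : H) (t : ℝ) :
    expNeg B t (B x) = B (expNeg B t x) :=
  DFunLike.congr_fun (expNeg_commute (Commute.refl B) t).eq x

variable [CompleteSpace H]

theorem expNeg_add (B : H →L[ℝ] H) (s t : ℝ) : expNeg B (s + t) = expNeg B s * expNeg B t := by
  let _ : NormedAlgebra ℚ (H →L[ℝ] H) := NormedAlgebra.restrictScalars ℚ ℝ (H →L[ℝ] H)
  rw [expNeg, add_smul]
  exact NormedSpace.exp_add_of_commute (((Commute.refl (-B)).smul_left s).smul_right t)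

theorem hasDerivAt_expNeg (B : H →L[ℝ] H) (x : H) (t : ℝ) :
    HasDerivAt (fun s => expNeg B s x) (-(expNeg B t (B x))) t := by
  have h := (hasDerivAt_exp_smul_const (𝕂 := ℝ) (-B) t).clm_apply (hasDerivAt_const t x)
  convert! h using 1
  simp [expNeg]

theorem norm_expNeg_apply_le {B : H →L[ℝ] H} (hB : ∀ x, 0 ≤ inner ℝ (B x) x) {t : ℝ} (ht : 0 ≤ t)
    (x : H) : ‖expNeg B t x‖ ≤ ‖x‖ := by
  have hd : ∀ s, HasDerivAt (fun s => ‖expNeg B s x‖ ^ 2)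
      (2 * inner ℝ (expNeg B s x) (-(expNeg B s (B x)))) s := fun s =>
    (hasDerivAt_expNeg B x s).norm_sq
  have hanti : Antitone fun s => ‖expNeg B s x‖ ^ 2 :=
    antitone_of_hasDerivAt_nonpos hd fun s => by
      have := hB (expNeg B s x)
      rw [expNeg_apply_comm, inner_neg_right, real_inner_comm]
      exact mul_nonpos_of_nonneg_of_nonpos zero_le_two (neg_nonpos.2 this)
  have := hanti ht
  simp only [expNeg_zero] at this
  exact le_of_sq_le_sq this (norm_nonneg x)

/-- Interpolate by `s ↦ exp (-(t - s) C) exp (-s B) x`. By commutation its derivative is two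
contractions applied to `C x - B x`. -/
theorem norm_expNeg_sub_expNeg_le {B C : H →L[ℝ] H} (hB : ∀ x, 0 ≤ inner ℝ (B x) x)
    (hC : ∀ x, 0 ≤ inner ℝ (C x) x) (hBC : Commute B C) {t : ℝ} (ht : 0 ≤ t) (x : H) :
    ‖expNeg B t x - expNeg C t x‖ ≤ t * ‖B x - C x‖ := by
  have hd : ∀ s, HasDerivAt (fun s => expNeg C (t - s) (expNeg B s x))
      (expNeg C (t - s) (expNeg B s (C x - B x))) s := fun s => by
    have h1 : HasDerivAt (fun s => expNeg C (t - s)) (-(expNeg C (t - s) * (-C))) s := by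
      have := (hasDerivAt_exp_smul_const (𝕂 := ℝ) (-C) (t - s)).scomp s
        ((hasDerivAt_id s).const_sub t)
      simpa [expNeg, Function.comp_def] using this
    have h2 := h1.clm_apply (hasDerivAt_expNeg B x s)
    convert! h2 using 1
    have h3 : expNeg B s (C x) = C (expNeg B s x) :=
      DFunLike.congr_fun (expNeg_commute hBC s).eq x
    simp [h3, sub_eq_add_neg]
  have h := norm_image_sub_le_of_norm_deriv_le_segment' (C := ‖B x - C x‖)
    (fun s _ => (hd s).hasDerivWithinAt) (fun s hs => ?_) t (right_mem_Icc.2 ht)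
  · simpa [expNeg_zero, mul_comm] using h
  · rw [norm_sub_rev (B x)]
    exact (norm_expNeg_apply_le hC (sub_nonneg.2 hs.2.le) _).trans
      (norm_expNeg_apply_le hB hs.1 _)

theorem norm_expNeg_sub_le {B : H →L[ℝ] H} (hB : ∀ x, 0 ≤ inner ℝ (B x) x) {s t : ℝ} (hs : 0 ≤ s)
    (ht : 0 ≤ t) (x : H) : ‖expNeg B t x - expNeg B s x‖ ≤ ‖B x‖ * |t - s| := by
  refine (convex_Ici (0 : ℝ)).norm_image_sub_le_of_norm_hasDerivWithin_le
    (fun r _ => (hasDerivAt_expNeg B x r).hasDerivWithinAt) (fun r hr => ?_) hs ht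
  rw [norm_neg]
  exact norm_expNeg_apply_le hB hr _

theorem expNeg_sub_eq_integral (B : H →L[ℝ] H) (x : H) (t : ℝ) :
    expNeg B t x - x = -∫ s in (0 : ℝ)..t, expNeg B s (B x) := by
  have hc : Continuous fun s => expNeg B s (B x) :=
    continuous_iff_continuousAt.2 fun s => (hasDerivAt_expNeg B (B x) s).continuousAt
  have := intervalIntegral.integral_eq_sub_of_hasDerivAt
    (fun s _ => hasDerivAt_expNeg B x s) (hc.neg.intervalIntegrable 0 t)
  rw [← intervalIntegral.integral_neg, this, expNeg_zero]
  rfl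

end Exponential

/-! ### The semigroup generated by `-A`. -/

section Generation

variable {H : Type*} [NormedAddCommGroup H] [InnerProductSpace ℝ H] {A : H →ₗ.[ℝ] H}

theorem mem_neg_graph_iff {x y : H} : (x, y) ∈ (-A).graph ↔ (x, -y) ∈ A.graph := by
  simp only [LinearPMap.mem_graph_iff]
  constructor
  · rintro ⟨z, hz, h⟩
    exact ⟨z, hz, by rw [← h, LinearPMap.neg_apply, neg_neg]⟩
  · rintro ⟨z, hz, h⟩
    exact ⟨z, hz, by rw [LinearPMap.neg_apply, h, neg_neg]⟩

/-- Pointwise limits of the semigroups generated by commuting bounded monotone approximations. -/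
theorem cauchySeq_expNeg [CompleteSpace H] (hA : IsMaximalMonotone A) {B : ℕ → H →L[ℝ] H}
    (hB : ∀ n x, 0 ≤ inner ℝ (B n x) x) (hBB : ∀ m n, Commute (B m) (B n))
    (hBA : ∀ x y, (x, y) ∈ A.graph → Tendsto (fun n => B n x) atTop (𝓝 y)) {t : ℝ} (ht : 0 ≤ t)
    (x : H) : CauchySeq fun n => expNeg (B n) t x := by
  rw [Metric.cauchySeq_iff]
  intro ε hε
  obtain ⟨z, hz, hxz⟩ := Metric.mem_closure_iff.1 (hA.dense_domain x) (ε / 4) (by positivity)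
  obtain ⟨y, hzy⟩ := LinearPMap.mem_domain_iff.1 hz
  obtain ⟨N, hN⟩ := Metric.cauchySeq_iff.1 (hBA z y hzy).cauchySeq (ε / (4 * (t + 1)))
    (by positivity)
  refine ⟨N, fun m hm n hn => ?_⟩
  have h1 := norm_expNeg_apply_le (hB m) ht (x - z)
  have h2 := norm_expNeg_apply_le (hB n) ht (x - z)
  have h3 := norm_expNeg_sub_expNeg_le (hB m) (hB n) (hBB m n) ht z
  have h4 : t * ‖B m z - B n z‖ ≤ ε / 4 := by
    have h5 := (hN m hm n hn).le
    rw [dist_eq_norm, le_div_iff₀ (by positivity)] at h5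
    nlinarith [norm_nonneg (B m z - B n z)]
  rw [dist_eq_norm] at hxz ⊢
  have h6 : expNeg (B m) t x - expNeg (B n) t x = expNeg (B m) t (x - z) -
      expNeg (B n) t (x - z) + (expNeg (B m) t z - expNeg (B n) t z) := by
    simp only [map_sub]; abel
  rw [h6]
  linarith [norm_add_le (expNeg (B m) t (x - z) - expNeg (B n) t (x - z))
    (expNeg (B m) t z - expNeg (B n) t z),
    norm_sub_le (expNeg (B m) t (x - z)) (expNeg (B n) t (x - z))]

theorem continuous_uncurry_of_dense {D : Set H} (hD : Dense D) {S : ℝ → H →L[ℝ] H}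
    (hS : ∀ t x, ‖S t x‖ ≤ ‖x‖) (hc : ∀ x ∈ D, Continuous fun t => S t x) :
    Continuous fun p : ℝ × H => S p.1 p.2 := by
  refine continuous_prod_of_dense_continuous_lipschitzWith' (fun p : ℝ × H => S p.1 p.2) 1 hD
    (fun t => LipschitzWith.of_dist_le_mul fun x y => ?_) hc
  simpa [dist_eq_norm] using hS t (x - y)

/-- The contraction semigroup generated by `-A`, extended by the identity to negative times. -/
theorem IsMaximalMonotone.exists_semigroup [CompleteSpace H] (hA : IsMaximalMonotone A) :
    ∃ S : ℝ → H →L[ℝ] H, IsContractionSemigroup S ∧ IsInfinitesimalGenerator S (-A) ∧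
      (∀ t x, ‖S t x‖ ≤ ‖x‖) ∧ Continuous fun p : ℝ × H => S p.1 p.2 := by
  obtain ⟨B, hB, hBB, hBle, hBA⟩ := hA.exists_approx
  -- The exponentials contract only forward in time; clamping at `0` makes the contraction bound and
  -- joint continuity hold for all real times.
  have hex : ∀ t : ℝ, ∃ L : H →L[ℝ] H, ∀ x,
      Tendsto (fun n => expNeg (B n) (max t 0) x) atTop (𝓝 (L x)) := fun t => by
    choose L hL using fun x =>
      cauchySeq_tendsto_of_complete (cauchySeq_expNeg hA hB hBB hBA (le_max_right t 0) x)
    exact ⟨continuousLinearMapOfTendsto _ (tendsto_pi_nhds.2 hL), hL⟩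
  choose S hS using hex
  have hS' : ∀ t, 0 ≤ t → ∀ x, Tendsto (fun n => expNeg (B n) t x) atTop (𝓝 (S t x)) :=
    fun t ht x => by simpa [max_eq_left ht] using hS t x
  have hle : ∀ t x, ‖S t x‖ ≤ ‖x‖ := fun t x =>
    le_of_tendsto' (hS t x).norm fun n => norm_expNeg_apply_le (hB n) (le_max_right _ _) x
  have hlip : ∀ x y, (x, y) ∈ A.graph → ∀ s t, ‖S t x - S s x‖ ≤ ‖y‖ * |t - s| :=
    fun x y hxy s t => le_of_tendsto' ((hS t x).sub (hS s x)).norm fun n =>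
      (norm_expNeg_sub_le (hB n) (le_max_right _ _) (le_max_right _ _) x).trans
        (mul_le_mul (hBle n x y hxy) (abs_max_sub_max_le_abs _ _ _) (abs_nonneg _)
          (norm_nonneg _))
  have hcont : Continuous fun p : ℝ × H => S p.1 p.2 := by
    refine continuous_uncurry_of_dense hA.dense_domain hle fun x hx => ?_
    obtain ⟨y, hxy⟩ := LinearPMap.mem_domain_iff.1 hx
    refine (LipschitzWith.of_dist_le_mul (K := ‖y‖₊) fun s t => ?_).continuous
    rw [dist_eq_norm, Real.dist_eq]
    exact hlip x y hxy t s
  have hcx : ∀ x, Continuous fun t => S t x := fun x =>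
    hcont.comp (continuous_id.prodMk continuous_const)
  have hcomp : ∀ t, 0 ≤ t → ∀ (u : ℕ → H) (z : H), Tendsto u atTop (𝓝 z) →
      Tendsto (fun n => expNeg (B n) t (u n)) atTop (𝓝 (S t z)) := fun t ht u z hu => by
    have h1 : Tendsto (fun n => expNeg (B n) t (u n - z)) atTop (𝓝 0) :=
      squeeze_zero_norm (fun n => norm_expNeg_apply_le (hB n) ht _)
        (tendsto_iff_norm_sub_tendsto_zero.1 hu)
    simpa using h1.add (hS' t ht z)
  have h0 : S 0 = ContinuousLinearMap.id ℝ H := ContinuousLinearMap.ext fun x =>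
    tendsto_nhds_unique (hS' 0 le_rfl x) (by simp [expNeg_zero])
  -- The integrated equation survives the pointwise limit by dominated convergence, with `‖y‖` as
  -- majorant; its derivative at `0` identifies the generator on `D(A)`.
  have hint : ∀ x y, (x, y) ∈ A.graph → ∀ t, 0 ≤ t → S t x - x = -∫ s in (0 : ℝ)..t, S s y :=
    fun x y hxy t ht => by
      refine tendsto_nhds_unique ((hS' t ht x).sub_const x) ?_
      simp_rw [expNeg_sub_eq_integral]
      refine Tendsto.neg (intervalIntegral.tendsto_integral_filter_of_dominated_convergence
        (fun _ => ‖y‖) (Eventually.of_forall fun n => ?_) (Eventually.of_forall fun n => ?_)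
        intervalIntegrable_const ?_)
      · exact (continuous_iff_continuousAt.2 fun s =>
          (hasDerivAt_expNeg (B n) (B n x) s).continuousAt).aestronglyMeasurable
      · refine ae_of_all _ fun s hs => ?_
        rw [uIoc_of_le ht] at hs
        exact (norm_expNeg_apply_le (hB n) hs.1.le _).trans (hBle n x y hxy)
      · refine ae_of_all _ fun s hs => ?_
        rw [uIoc_of_le ht] at hs
        exact hcomp s hs.1.le _ _ (hBA x y hxy)
  have hder : ∀ x y, (x, y) ∈ A.graph →
      Tendsto (fun h : ℝ => h⁻¹ • (S h x - x)) (𝓝[>] 0) (𝓝 (-y)) := fun x y hxy => by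
    have h1 : HasDerivAt (fun t => ∫ s in (0 : ℝ)..t, S s y) (S 0 y) 0 :=
      intervalIntegral.integral_hasDerivAt_right ((hcx y).intervalIntegrable _ _)
        ((hcx y).stronglyMeasurableAtFilter _ _) (hcx y).continuousAt
    have h2 := (hasDerivAt_iff_tendsto_slope_zero.1 h1).mono_left
      (nhdsWithin_mono 0 fun t (ht : 0 < t) => ht.ne')
    rw [h0] at h2
    refine h2.neg.congr' ?_
    filter_upwards [self_mem_nhdsWithin] with h hh
    simp [hint x y hxy h (le_of_lt hh)]
  refine ⟨S, ⟨h0, fun s t hs ht => ?_, fun x => (hcx x).continuousOn, fun t _ x y => ?_⟩,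
    fun x y => ?_, hle, hcont⟩
  · refine ContinuousLinearMap.ext fun x =>
      tendsto_nhds_unique (hS' (s + t) (add_nonneg hs ht) x) ?_
    simp_rw [expNeg_add]
    exact hcomp s hs _ _ (hS' t ht x)
  · rw [← map_sub]; exact hle t _
  · rw [mem_neg_graph_iff]
    -- Difference quotients of a contraction are dissipative, so a generator pair is, up to sign,
    -- monotonically related to the graph of `A`.
    refine ⟨fun h => by simpa using hder _ _ h, fun h => hA.mem_graph_of_forall fun z w hzw => ?_⟩
    have h1 := ((hder z w hzw).sub h).inner (𝕜 := ℝ) (tendsto_const_nhds (x := z - x))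
    have h2 : inner ℝ (-w - y) (z - x) ≤ 0 := by
      refine le_of_tendsto h1 ?_
      filter_upwards [self_mem_nhdsWithin] with r hr
      have h3 : r⁻¹ • (S r z - z) - r⁻¹ • (S r x - x) = r⁻¹ • (S r (z - x) - (z - x)) := by
        rw [← smul_sub, map_sub]; congr 1; abel
      rw [h3, real_inner_smul_left, inner_sub_left, real_inner_self_eq_norm_sq]
      refine mul_nonpos_of_nonneg_of_nonpos (inv_nonneg.2 (le_of_lt hr)) ?_
      have h4 := real_inner_le_norm (S r (z - x)) (z - x)
      nlinarith [hle r (z - x), norm_nonneg (z - x)]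
    have h5 : w - -y = -(-w - y) := by abel
    rw [h5, inner_neg_left]
    linarith

theorem IsInfinitesimalGenerator.tendsto_slope {S : ℝ → H →L[ℝ] H}
    (hG : IsInfinitesimalGenerator S (-A)) {x y : H} (h : (x, y) ∈ A.graph) :
    Tendsto (fun h : ℝ => h⁻¹ • (S h x - x)) (𝓝[>] 0) (𝓝 (-y)) :=
  (hG x (-y)).1 (mem_neg_graph_iff.2 (by rwa [neg_neg]))

theorem IsInfinitesimalGenerator.mem_graph {S : ℝ → H →L[ℝ] H}
    (hG : IsInfinitesimalGenerator S (-A)) {x y : H}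
    (h : Tendsto (fun h : ℝ => h⁻¹ • (S h x - x)) (𝓝[>] 0) (𝓝 (-y))) : (x, y) ∈ A.graph := by
  simpa using mem_neg_graph_iff.1 ((hG x (-y)).2 h)

theorem hasDerivWithinAt_Ici_iff_tendsto {u : ℝ → H} {u' : H} {t : ℝ} :
    HasDerivWithinAt u u' (Ici t) t ↔
      Tendsto (fun h : ℝ => h⁻¹ • (u (t + h) - u t)) (𝓝[>] 0) (𝓝 u') := by
  have : 𝓝[>] t = Filter.map (fun h => t + h) (𝓝[>] 0) := by simp
  rw [← hasDerivWithinAt_Ioi_iff_Ici, hasDerivWithinAt_iff_tendsto_slope' self_notMem_Ioi, this,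
    tendsto_map'_iff]
  simp [slope, Function.comp_def]

end Generation

/-! ### Uniqueness of the semigroup. -/

section Uniqueness

variable {H : Type*} [NormedAddCommGroup H] [InnerProductSpace ℝ H] {A : H →ₗ.[ℝ] H}

theorem IsContractionSemigroup.hasDerivWithinAt_orbit {S : ℝ → H →L[ℝ] H}
    (hS : IsContractionSemigroup S) (hG : IsInfinitesimalGenerator S (-A)) {x y : H}
    (h : (x, y) ∈ A.graph) {t : ℝ} (ht : 0 ≤ t) :
    HasDerivWithinAt (fun s => S s x) (-(S t y)) (Ici t) t := by
  rw [hasDerivWithinAt_Ici_iff_tendsto, ← map_neg]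
  refine (((S t).continuous.tendsto _).comp (hG.tendsto_slope h)).congr' ?_
  filter_upwards [self_mem_nhdsWithin] with r hr
  simp [hS.map_add t r ht (le_of_lt hr)]

theorem IsContractionSemigroup.orbit_mem_graph {S : ℝ → H →L[ℝ] H}
    (hS : IsContractionSemigroup S) (hG : IsInfinitesimalGenerator S (-A)) {x y : H}
    (h : (x, y) ∈ A.graph) {t : ℝ} (ht : 0 ≤ t) : (S t x, S t y) ∈ A.graph := by
  refine hG.mem_graph ?_
  refine (hasDerivWithinAt_Ici_iff_tendsto.1 (hS.hasDerivWithinAt_orbit hG h ht)).congr' ?_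
  filter_upwards [self_mem_nhdsWithin] with r hr
  rw [add_comm t r, hS.map_add r t (le_of_lt hr) ht]
  rfl

/-- The contraction semigroup generated by `-A` is unique. -/
theorem IsContractionSemigroup.eq_of_generator [CompleteSpace H] (hA : IsMaximalMonotone A)
    {S S' : ℝ → H →L[ℝ] H} (hS : IsContractionSemigroup S) (hS' : IsContractionSemigroup S')
    (hG : IsInfinitesimalGenerator S (-A)) (hG' : IsInfinitesimalGenerator S' (-A)) {t : ℝ}
    (ht : 0 ≤ t) : S t = S' t := by
  refine DFunLike.coe_injective
    ((S t).continuous.ext_on hA.dense_domain (S' t).continuous fun x hx => ?_)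
  obtain ⟨y, hxy⟩ := LinearPMap.mem_domain_iff.1 hx
  -- Both orbits stay in the domain, so monotonicity of `A` makes this right derivative nonpositive.
  have hd : ∀ s ∈ Ico 0 t, HasDerivWithinAt (fun s => ‖S s x - S' s x‖ ^ 2)
      (2 * inner ℝ (S s x - S' s x) (-(S s y) - -(S' s y))) (Ici s) s := fun s hs =>
    ((hS.hasDerivWithinAt_orbit hG hxy hs.1).sub
      (hS'.hasDerivWithinAt_orbit hG' hxy hs.1)).norm_sq
  have hc : ContinuousOn (fun s => ‖S s x - S' s x‖ ^ 2) (Icc 0 t) :=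
    (((hS.strongly_continuous x).sub (hS'.strongly_continuous x)).norm.pow 2).mono
      Icc_subset_Ici_self
  have h0 := image_le_of_deriv_right_le_deriv_boundary hc hd (B := fun _ => 0) (B' := fun _ => 0)
    (by simp [hS.map_zero, hS'.map_zero]) continuousOn_const
    (fun s _ => hasDerivWithinAt_const _ _ _) (fun s hs => by
      have h1 := hA.inner_nonneg (A.graph.sub_mem (hS.orbit_mem_graph hG hxy hs.1)
        (hS'.orbit_mem_graph hG' hxy hs.1))
      have h2 : -(S s y) - -(S' s y) = -(S s y - S' s y) := by abel
      rw [h2, inner_neg_right, real_inner_comm]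
      exact mul_nonpos_of_nonneg_of_nonpos zero_le_two (neg_nonpos.2 h1)) (right_mem_Icc.2 ht)
  exact sub_eq_zero.1 (norm_eq_zero.1 (pow_eq_zero_iff two_ne_zero |>.1
    (le_antisymm h0 (sq_nonneg _))))

end Uniqueness

/-! ### Integrability and continuity of the Duhamel integral. -/

section Duhamel

variable {H : Type*} [NormedAddCommGroup H] [InnerProductSpace ℝ H] {S : ℝ → H →L[ℝ] H}

theorem aestronglyMeasurable_duhamel (hc : Continuous fun p : ℝ × H => S p.1 p.2) {g : ℝ → H}
    {μ : Measure ℝ} (hg : AEStronglyMeasurable g μ) (t : ℝ) :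
    AEStronglyMeasurable (fun s => S (t - s) (g s)) μ :=
  hc.comp_aestronglyMeasurable
    ((continuous_const.sub continuous_id).aestronglyMeasurable.prodMk hg)

theorem intervalIntegrable_duhamel (hle : ∀ t x, ‖S t x‖ ≤ ‖x‖)
    (hc : Continuous fun p : ℝ × H => S p.1 p.2) {g : ℝ → H} {a b : ℝ}
    (hg : IntervalIntegrable g volume a b) (t : ℝ) :
    IntervalIntegrable (fun s => S (t - s) (g s)) volume a b :=
  hg.mono_fun (aestronglyMeasurable_duhamel hc hg.aestronglyMeasurable_restrict_uIoc t)
    (ae_of_all _ fun s => hle (t - s) (g s))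

/-- With the variable endpoint turned into an indicator, dominated convergence applies on the fixed
interval: the integrand is continuous in `t` at `t₀` except for `s = t₀`, a null set. -/
theorem continuousOn_duhamel (hle : ∀ t x, ‖S t x‖ ≤ ‖x‖)
    (hc : Continuous fun p : ℝ × H => S p.1 p.2) {g : ℝ → H} {T : ℝ}
    (hg : IntervalIntegrable g volume 0 T) :
    ContinuousOn (fun t => ∫ s in (0 : ℝ)..t, S (t - s) (g s)) (Icc 0 T) := by
  have hm : ∀ t, AEStronglyMeasurable
      ({s | s ≤ t}.indicator fun s => S (t - s) (g s)) (volume.restrict (uIoc 0 T)) := fun t =>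
    (aestronglyMeasurable_duhamel hc hg.aestronglyMeasurable_restrict_uIoc t).indicator
      measurableSet_Iic
  have h : Continuous fun t => ∫ s in (0 : ℝ)..T,
      {s | s ≤ t}.indicator (fun s => S (t - s) (g s)) s := by
    refine continuous_iff_continuousAt.2 fun t₀ =>
      intervalIntegral.continuousAt_of_dominated_interval (bound := fun s => ‖g s‖)
        (Eventually.of_forall hm) (Eventually.of_forall fun t => ae_of_all _ fun s _ =>
          (norm_indicator_le_norm_self _ _).trans (hle _ _)) hg.norm ?_
    filter_upwards [compl_mem_ae_iff.2 (measure_singleton t₀)] with s hs _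
    have hcs : Continuous fun t => S (t - s) (g s) :=
      hc.comp ((continuous_id.sub continuous_const).prodMk continuous_const)
    rcases lt_or_gt_of_ne (show s ≠ t₀ from hs) with h1 | h1
    · refine hcs.continuousAt.congr ?_
      filter_upwards [lt_mem_nhds h1] with t ht
      rw [indicator_of_mem]
      exact le_of_lt ht
    · refine (continuousAt_const (y := (0 : H))).congr ?_
      filter_upwards [gt_mem_nhds h1] with t ht
      rw [indicator_of_notMem]
      exact not_le_of_gt ht
  refine h.continuousOn.congr fun t ht => ?_
  exact (intervalIntegral.integral_indicator ht).symm

end Duhamel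

/-- Grönwall's inequality in integral form. -/
theorem le_mul_exp_of_le_add_mul_integral {φ : ℝ → ℝ} {a M T : ℝ} (hφ : ContinuousOn φ (Icc 0 T))
    (hM : 0 ≤ M) (h : ∀ t ∈ Icc 0 T, φ t ≤ a + M * ∫ s in (0 : ℝ)..t, φ s) {t : ℝ}
    (ht : t ∈ Icc 0 T) : φ t ≤ a * Real.exp (M * t) := by
  have hT : 0 ≤ T := ht.1.trans ht.2
  -- A globally continuous extension makes the primitive differentiable at the endpoints too.
  have hc : Continuous (IccExtend hT ((Icc 0 T).domRestrict φ)) :=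
    hφ.domRestrict.Icc_extend'
  set ψ := IccExtend hT ((Icc 0 T).domRestrict φ)
  have hψ : ∀ s ∈ Icc 0 T, ψ s = φ s := fun s hs => IccExtend_of_mem _ _ hs
  have hi : ∀ t ∈ Icc 0 T, ∫ s in (0 : ℝ)..t, φ s = ∫ s in (0 : ℝ)..t, ψ s := fun t ht =>
    intervalIntegral.integral_congr fun s hs => by
      rw [uIcc_of_le ht.1] at hs
      exact (hψ s ⟨hs.1, hs.2.trans ht.2⟩).symm
  have hd : ∀ t, HasDerivAt (fun t => a + M * ∫ s in (0 : ℝ)..t, ψ s) (M * ψ t) t := fun t =>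
    ((intervalIntegral.integral_hasDerivAt_right (hc.intervalIntegrable _ _)
      (hc.stronglyMeasurableAtFilter _ _) hc.continuousAt).const_mul M).const_add a
  have hle : ∀ t ∈ Icc 0 T, ψ t ≤ a + M * ∫ s in (0 : ℝ)..t, ψ s := fun t ht => by
    rw [hψ t ht, ← hi t ht]; exact h t ht
  have hg := le_gronwallBound_of_liminf_deriv_right_le (δ := a) (K := M) (ε := 0)
    (fun t _ => (hd t).continuousAt.continuousWithinAt)
    (fun t _ r hr => (hd t).hasDerivWithinAt.liminf_right_slope_le hr) (by simp)
    (fun t ht => by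
      rw [add_zero]
      exact mul_le_mul_of_nonneg_left (hle t (Ico_subset_Icc_self ht)) hM) t ht
  rw [gronwallBound_ε0, sub_zero] at hg
  exact (hψ t ht).symm.trans_le ((hle t ht).trans hg)

theorem MeasureTheory.MemLp.exists_ae_norm_le {α E : Type*} [MeasurableSpace α]
    [NormedAddCommGroup E] {μ : Measure α} {f : α → E} (hf : MemLp f ⊤ μ) :
    ∃ M : ℝ, 0 ≤ M ∧ ∀ᵐ s ∂μ, ‖f s‖ ≤ M := by
  refine ⟨(eLpNorm f ⊤ μ).toReal, ENNReal.toReal_nonneg, ?_⟩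
  filter_upwards [ae_le_eLpNormEssSup (f := f) (μ := μ)] with s hs
  rw [← eLpNorm_exponent_top] at hs
  simpa using ENNReal.toReal_mono hf.2.ne hs

/-! ### Existence and uniqueness of mild solutions. -/

section Mild

variable {H : Type*} [NormedAddCommGroup H] [InnerProductSpace ℝ H] {S : ℝ → H →L[ℝ] H}
  {f : ℝ → H →L[ℝ] H} {d X Y : ℝ → H} {X₀ : H} {T : ℝ}

theorem intervalIntegrable_forcing (hf : MemLp f ⊤ (volume.restrict (Icc 0 T)))
    (hd : IntegrableOn d (Icc 0 T)) (hX : ContinuousOn X (Icc 0 T)) {t : ℝ} (ht : t ∈ Icc 0 T) :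
    IntervalIntegrable (fun s => f s (X s) + d s) volume 0 t := by
  obtain ⟨M, hM, hfM⟩ := hf.exists_ae_norm_le
  obtain ⟨R, hR⟩ := isCompact_Icc.exists_bound_of_continuousOn hX
  have hXm : AEStronglyMeasurable X (volume.restrict (Icc 0 T)) :=
    hX.aestronglyMeasurable measurableSet_Icc
  have h1 : IntegrableOn (fun s => f s (X s)) (Icc 0 T) := by
    refine IntegrableOn.of_bound (by simp) 
      (isBoundedBilinearMap_apply.continuous.comp_aestronglyMeasurable (hf.1.prodMk hXm)) (M * R) ?_
    filter_upwards [hfM, ae_restrict_mem measurableSet_Icc] with s hs hsT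
    exact (f s).le_of_opNorm_le_of_le hs (hR s hsT)
  have h2 : IntegrableOn (fun s => f s (X s) + d s) (Icc 0 T) := h1.add hd
  refine IntegrableOn.intervalIntegrable (h2.mono_set ?_)
  rw [uIcc_of_le ht.1]
  exact Icc_subset_Icc_right ht.2

theorem norm_integral_duhamel_sub_le (hle : ∀ t x, ‖S t x‖ ≤ ‖x‖)
    (hc : Continuous fun p : ℝ × H => S p.1 p.2) (hf : MemLp f ⊤ (volume.restrict (Icc 0 T)))
    (hd : IntegrableOn d (Icc 0 T)) {M : ℝ}
    (hfM : ∀ᵐ s ∂volume.restrict (Icc 0 T), ‖f s‖ ≤ M) (hX : ContinuousOn X (Icc 0 T))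
    (hY : ContinuousOn Y (Icc 0 T)) {t : ℝ} (ht : t ∈ Icc 0 T) :
    ‖(∫ s in (0 : ℝ)..t, S (t - s) (f s (X s) + d s)) -
      ∫ s in (0 : ℝ)..t, S (t - s) (f s (Y s) + d s)‖ ≤ M * ∫ s in (0 : ℝ)..t, ‖X s - Y s‖ := by
  have hsub : Icc 0 t ⊆ Icc 0 T := Icc_subset_Icc_right ht.2
  rw [← intervalIntegral.integral_sub
    (intervalIntegrable_duhamel hle hc (intervalIntegrable_forcing hf hd hX ht) t)
    (intervalIntegrable_duhamel hle hc (intervalIntegrable_forcing hf hd hY ht) t),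
    ← intervalIntegral.integral_const_mul]
  refine intervalIntegral.norm_integral_le_of_norm_le ht.1 ?_ ?_
  · filter_upwards [(ae_restrict_iff' measurableSet_Icc).1 hfM] with s hs hst
    have h1 := hs (hsub (Ioc_subset_Icc_self hst))
    have h2 : S (t - s) (f s (X s) + d s) - S (t - s) (f s (Y s) + d s) =
        S (t - s) (f s (X s - Y s)) := by
      rw [← map_sub, map_sub (f s)]; congr 1; abel
    rw [h2]
    exact (hle _ _).trans ((f s).le_of_opNorm_le h1 _)
  · refine ContinuousOn.intervalIntegrable ?_
    rw [uIcc_of_le ht.1]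
    exact (continuousOn_const.mul (hX.sub hY).norm).mono hsub

theorem duhamel_unique (hle : ∀ t x, ‖S t x‖ ≤ ‖x‖)
    (hc : Continuous fun p : ℝ × H => S p.1 p.2) (hf : MemLp f ⊤ (volume.restrict (Icc 0 T)))
    (hd : IntegrableOn d (Icc 0 T)) (hX : ContinuousOn X (Icc 0 T))
    (hY : ContinuousOn Y (Icc 0 T))
    (hXd : ∀ t ∈ Icc 0 T, X t = S t X₀ + ∫ s in (0 : ℝ)..t, S (t - s) (f s (X s) + d s))
    (hYd : ∀ t ∈ Icc 0 T, Y t = S t X₀ + ∫ s in (0 : ℝ)..t, S (t - s) (f s (Y s) + d s)) :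
    EqOn X Y (Icc 0 T) := by
  obtain ⟨M, hM, hfM⟩ := hf.exists_ae_norm_le
  intro t ht
  have h := le_mul_exp_of_le_add_mul_integral (a := 0) (hX.sub hY).norm hM (fun t ht => by
    rw [zero_add]
    refine le_of_eq_of_le ?_ (norm_integral_duhamel_sub_le hle hc hf hd hfM hX hY ht)
    rw [Pi.sub_apply, hXd t ht, hYd t ht, add_sub_add_left_eq_sub]) ht
  rw [zero_mul] at h
  exact sub_eq_zero.1 (norm_le_zero_iff.1 h)

/-- Integrating the weight `exp ((M + 1) s)` gains `1 / (M + 1)`, which beats the Lipschitz constant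
`M` whatever the length of the interval. -/
theorem norm_integral_duhamel_sub_le_exp (hle : ∀ t x, ‖S t x‖ ≤ ‖x‖)
    (hc : Continuous fun p : ℝ × H => S p.1 p.2) (hf : MemLp f ⊤ (volume.restrict (Icc 0 T)))
    (hd : IntegrableOn d (Icc 0 T)) {M D : ℝ} (hM : 0 ≤ M) (hD : 0 ≤ D)
    (hfM : ∀ᵐ s ∂volume.restrict (Icc 0 T), ‖f s‖ ≤ M) (hX : ContinuousOn X (Icc 0 T))
    (hY : ContinuousOn Y (Icc 0 T))
    (hXY : ∀ s ∈ Icc 0 T, ‖X s - Y s‖ ≤ Real.exp ((M + 1) * s) * D) {t : ℝ}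
    (ht : t ∈ Icc 0 T) :
    ‖(∫ s in (0 : ℝ)..t, S (t - s) (f s (X s) + d s)) -
      ∫ s in (0 : ℝ)..t, S (t - s) (f s (Y s) + d s)‖ ≤
        Real.exp ((M + 1) * t) * (M / (M + 1) * D) := by
  have hk : 0 < M + 1 := by positivity
  have hsub : Icc 0 t ⊆ Icc 0 T := Icc_subset_Icc_right ht.2
  have h2 : ∫ s in (0 : ℝ)..t, ‖X s - Y s‖ ≤
      ∫ s in (0 : ℝ)..t, Real.exp ((M + 1) * s) * D := by
    refine intervalIntegral.integral_mono_on ht.1 (ContinuousOn.intervalIntegrable ?_)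
      (Continuous.intervalIntegrable (by fun_prop) _ _) fun s hs => hXY s (hsub hs)
    rw [uIcc_of_le ht.1]
    exact (hX.sub hY).norm.mono hsub
  have h3 : ∫ s in (0 : ℝ)..t, Real.exp ((M + 1) * s) * D ≤
      Real.exp ((M + 1) * t) / (M + 1) * D := by
    rw [intervalIntegral.integral_mul_const,
      intervalIntegral.integral_comp_mul_left (fun x => Real.exp x) hk.ne', integral_exp,
      mul_zero, Real.exp_zero, smul_eq_mul, inv_mul_eq_div]
    gcongr
    linarith
  refine (norm_integral_duhamel_sub_le hle hc hf hd hfM hX hY ht).trans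
    ((mul_le_mul_of_nonneg_left (h2.trans h3) hM).trans_eq ?_)
  ring

theorem duhamel_exists [CompleteSpace H] (hle : ∀ t x, ‖S t x‖ ≤ ‖x‖)
    (hc : Continuous fun p : ℝ × H => S p.1 p.2) (hT : 0 ≤ T)
    (hf : MemLp f ⊤ (volume.restrict (Icc 0 T))) (hd : IntegrableOn d (Icc 0 T)) (X₀ : H) :
    ∃ X : ℝ → H, ContinuousOn X (Icc 0 T) ∧
      ∀ t ∈ Icc 0 T, X t = S t X₀ + ∫ s in (0 : ℝ)..t, S (t - s) (f s (X s) + d s) := by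
  obtain ⟨M, hM, hfM⟩ := hf.exists_ae_norm_le
  have hk : 0 < M + 1 := by positivity
  -- Factoring the weight out of the unknown turns the weighted norm into the usual sup norm of `Z`.
  let ext : C(Icc 0 T, H) → ℝ → H := fun Z s => Real.exp ((M + 1) * s) • Z (projIcc 0 T hT s)
  have hext : ∀ Z, Continuous (ext Z) := fun Z =>
    (by fun_prop : Continuous fun s : ℝ => Real.exp ((M + 1) * s)).smul
      (Z.continuous.comp continuous_projIcc)
  have hexp : ∀ r x, Real.exp r • Real.exp (-r) • (x : H) = x := fun r x => by
    rw [smul_smul, ← Real.exp_add, add_neg_cancel, Real.exp_zero, one_smul]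
  obtain ⟨F, hF⟩ : ∃ F : (ℝ → H) → ℝ → H, ∀ X t,
    F X t = S t X₀ + ∫ s in (0 : ℝ)..t, S (t - s) (f s (X s) + d s) := ⟨_, fun _ _ => rfl⟩
  have hFc : ∀ Z, ContinuousOn (F (ext Z)) (Icc 0 T) := fun Z =>
    ((hc.comp (continuous_id.prodMk continuous_const)).continuousOn.add
      (continuousOn_duhamel hle hc (intervalIntegrable_forcing hf hd (hext Z).continuousOn
        (right_mem_Icc.2 hT)))).congr fun t _ => hF _ t
  let Φ : C(Icc 0 T, H) → C(Icc 0 T, H) := fun Z =>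
    ⟨fun t => Real.exp (-((M + 1) * t)) • F (ext Z) t,
      (by fun_prop : Continuous fun t : Icc 0 T => Real.exp (-((M + 1) * (t : ℝ)))).smul
        (hFc Z).domRestrict⟩
  have hlip : ∀ Z W, dist (Φ Z) (Φ W) ≤ M / (M + 1) * dist Z W := fun Z W => by
    rw [ContinuousMap.dist_le (by positivity)]
    intro t
    have h1 := norm_integral_duhamel_sub_le_exp hle hc hf hd hM (dist_nonneg (x := Z) (y := W))
      hfM (hext Z).continuousOn (hext W).continuousOn (fun s hs => by
        rw [← smul_sub, norm_smul, Real.norm_of_nonneg (Real.exp_nonneg _), ← dist_eq_norm]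
        exact mul_le_mul_of_nonneg_left (ContinuousMap.dist_apply_le_dist _)
          (Real.exp_nonneg _)) t.2
    rw [← add_sub_add_left_eq_sub _ _ (S t X₀), ← hF, ← hF] at h1
    change dist (Real.exp (-((M + 1) * t)) • F (ext Z) t)
      (Real.exp (-((M + 1) * t)) • F (ext W) t) ≤ _
    rw [dist_eq_norm, ← smul_sub, norm_smul, Real.norm_of_nonneg (Real.exp_nonneg _),
      Real.exp_neg, inv_mul_le_iff₀ (Real.exp_pos _)]
    exact h1
  obtain ⟨Z, hZ⟩ : ∃ Z, Φ Z = Z := by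
    have hΦ : ContractingWith (Real.toNNReal (M / (M + 1))) Φ := by
      refine ⟨?_, LipschitzWith.of_dist_le_mul fun Z W => ?_⟩
      · rw [Real.toNNReal_lt_one, div_lt_one hk]; linarith
      · rw [Real.coe_toNNReal _ (by positivity)]
        exact hlip Z W
    have : Nonempty C(Icc 0 T, H) := ⟨0⟩
    exact ⟨ContractingWith.fixedPoint Φ hΦ, hΦ.fixedPoint_isFixedPt⟩
  refine ⟨ext Z, (hext Z).continuousOn, fun t ht => ?_⟩
  rw [← hF]
  have h1 : Z ⟨t, ht⟩ = Real.exp (-((M + 1) * t)) • F (ext Z) t := by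
    conv_lhs => rw [← hZ]
    rfl
  change Real.exp ((M + 1) * t) • Z (projIcc 0 T hT t) = _
  rw [projIcc_of_mem hT ht, h1, hexp]

end Mild

/-! ### Time regularity of the Duhamel formula. -/

section Regularity

variable {H : Type*} [NormedAddCommGroup H] [InnerProductSpace ℝ H] {A : H →ₗ.[ℝ] H}
  {S : ℝ → H →L[ℝ] H} {X g : ℝ → H} {X₀ : H} {T : ℝ}

/-- Vectors along whose orbit the semigroup is Lipschitz at time zero are in the domain of its
generator. -/
theorem IsMaximalMonotone.mem_domain_of_norm_sub_le [CompleteSpace H] (hA : IsMaximalMonotone A)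
    (hle : ∀ t x, ‖S t x‖ ≤ ‖x‖) (hG : IsInfinitesimalGenerator S (-A)) {x : H} {C : ℝ}
    (h : ∀ᶠ r in 𝓝[>] (0 : ℝ), ‖S r x - x‖ ≤ C * r) : x ∈ A.domain := by
  -- The difference quotients are bounded, so Banach–Alaoglu gives a weak limit along an
  -- ultrafilter. This is enough, since the maximality test only pairs them with fixed vectors.
  let q : ℝ → WeakDual ℝ H := fun r =>
    StrongDual.toWeakDual (InnerProductSpace.toDual ℝ H (r⁻¹ • (S r x - x)))
  let U : Ultrafilter ℝ := Ultrafilter.of (𝓝[>] (0 : ℝ))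
  have hU : (U : Filter ℝ) ≤ 𝓝[>] 0 := Ultrafilter.of_le _
  have hq : ∀ᶠ r in U, q r ∈ WeakDual.toStrongDual ⁻¹' Metric.closedBall (0 : StrongDual ℝ H) C := by
    filter_upwards [hU h, hU self_mem_nhdsWithin] with r hr hr0
    have hr0 : 0 < r := hr0
    simp only [q, mem_preimage, mem_closedBall_zero_iff]
    change ‖InnerProductSpace.toDual ℝ H (r⁻¹ • (S r x - x))‖ ≤ C
    rw [LinearIsometryEquiv.norm_map, norm_smul, norm_inv, Real.norm_of_nonneg hr0.le,
      inv_mul_le_iff₀ hr0, mul_comm]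
    exact hr
  obtain ⟨φ, -, hφ⟩ := (WeakDual.isCompact_closedBall (0 : StrongDual ℝ H) C).ultrafilter_le_nhds
    (U.map q) (le_principal_iff.2 hq)
  have hφ' : Tendsto q U (𝓝 φ) := hφ
  obtain ⟨y, hy⟩ := (InnerProductSpace.toDual ℝ H).surjective (WeakDual.toStrongDual φ)
  have hlim : ∀ z, Tendsto (fun r => inner ℝ (r⁻¹ • (S r x - x)) z) U (𝓝 (inner ℝ y z)) :=
    fun z => by
      have h1 := ((WeakDual.eval_continuous z).tendsto φ).comp hφ'
      have h2 : φ z = inner ℝ y z := by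
        rw [← InnerProductSpace.toDual_apply_apply (𝕜 := ℝ), hy]; rfl
      rw [h2] at h1
      exact h1
  refine LinearPMap.mem_domain_of_mem_graph
    (y := -y) (hA.mem_graph_of_forall fun z w hzw => ?_)
  have h1 := (((hG.tendsto_slope hzw).mono_left hU).inner (𝕜 := ℝ)
    (tendsto_const_nhds (x := z - x))).sub (hlim (z - x))
  have h2 : inner ℝ (-w) (z - x) - inner ℝ y (z - x) ≤ 0 := by
    refine le_of_tendsto h1 ?_
    filter_upwards [hU self_mem_nhdsWithin] with r hr
    have h3 : r⁻¹ • (S r z - z) - r⁻¹ • (S r x - x) = r⁻¹ • (S r (z - x) - (z - x)) := by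
      rw [← smul_sub, map_sub]; congr 1; abel
    rw [← inner_sub_left, h3, real_inner_smul_left, inner_sub_left, real_inner_self_eq_norm_sq]
    refine mul_nonpos_of_nonneg_of_nonpos (inv_nonneg.2 (le_of_lt hr)) ?_
    have h4 := real_inner_le_norm (S r (z - x)) (z - x)
    nlinarith [hle r (z - x), norm_nonneg (z - x)]
  have h5 : w - -y = -(-w - y) := by abel
  rw [h5, inner_neg_left, inner_sub_left]
  linarith

theorem duhamel_restart [CompleteSpace H] (hS : IsContractionSemigroup S)
    (hle : ∀ t x, ‖S t x‖ ≤ ‖x‖)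
    (hc : Continuous fun p : ℝ × H => S p.1 p.2) (hg : ContinuousOn g (Ici 0))
    (hX : ∀ t, 0 ≤ t → X t = S t X₀ + ∫ s in (0 : ℝ)..t, S (t - s) (g s)) {r t : ℝ} (hr : 0 ≤ r)
    (hrt : r ≤ t) : X t = S (t - r) (X r) + ∫ s in r..t, S (t - s) (g s) := by
  have hi : ∀ a b, 0 ≤ a → a ≤ b → ∀ t, IntervalIntegrable (fun s => S (t - s) (g s)) volume a b :=
    fun a b ha hab t => intervalIntegrable_duhamel hle hc
      (ContinuousOn.intervalIntegrable (hg.mono (by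
        rw [uIcc_of_le hab]; exact fun s hs => ha.trans hs.1))) t
  have h1 : S (t - r) (∫ s in (0 : ℝ)..r, S (r - s) (g s)) =
      ∫ s in (0 : ℝ)..r, S (t - s) (g s) := by
    rw [← ContinuousLinearMap.intervalIntegral_comp_comm _ (hi 0 r le_rfl hr r)]
    refine intervalIntegral.integral_congr fun s hs => ?_
    rw [uIcc_of_le hr] at hs
    have h2 : t - s = (t - r) + (r - s) := by ring
    simp only [h2, hS.map_add _ _ (sub_nonneg.2 hrt) (sub_nonneg.2 hs.2)]
    rfl
  have h3 : S (t - r) (S r X₀) = S t X₀ := by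
    have h2 : t = (t - r) + r := by ring
    nth_rw 2 [h2]
    rw [hS.map_add _ _ (sub_nonneg.2 hrt) hr]
    rfl
  rw [hX t (hr.trans hrt), hX r hr, map_add, h1, h3, add_assoc,
    intervalIntegral.integral_add_adjacent_intervals (hi 0 r le_rfl hr t) (hi r t hr hrt t)]

/-- Restart the formula at `r` and at `r + h` and subtract: the increment propagates by the
semigroup, up to the increment of the forcing. It serves twice, from `r = 0` for the Lipschitz bound
and from general `r` for continuity of the derivative. -/
theorem norm_duhamel_shift_sub_le [CompleteSpace H] (hS : IsContractionSemigroup S)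
    (hle : ∀ t x, ‖S t x‖ ≤ ‖x‖)
    (hc : Continuous fun p : ℝ × H => S p.1 p.2) (hg : ContinuousOn g (Ici 0))
    (hX : ∀ t, 0 ≤ t → X t = S t X₀ + ∫ s in (0 : ℝ)..t, S (t - s) (g s)) {r t h : ℝ} (hr : 0 ≤ r)
    (hrt : r ≤ t) (hh : 0 ≤ h) {b : ℝ → ℝ} (hb : IntervalIntegrable b volume r t)
    (hgb : ∀ s ∈ Icc r t, ‖g (s + h) - g s‖ ≤ b s) :
    ‖(X (t + h) - X t) - S (t - r) (X (r + h) - X r)‖ ≤ ∫ s in r..t, b s := by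
  have hgi : IntervalIntegrable g volume r t := ContinuousOn.intervalIntegrable (hg.mono (by
    rw [uIcc_of_le hrt]; exact fun s hs => hr.trans hs.1))
  have hgi' : IntervalIntegrable (fun s => g (s + h)) volume r t :=
    ContinuousOn.intervalIntegrable (hg.comp (by fun_prop) (by
      rw [uIcc_of_le hrt]; exact fun s hs => add_nonneg (hr.trans hs.1) hh))
  have h1 : ∫ s in (r + h)..(t + h), S (t + h - s) (g s) = ∫ s in r..t, S (t - s) (g (s + h)) := by
    rw [← intervalIntegral.integral_comp_add_right]
    simp
  have h2 : (X (t + h) - X t) - S (t - r) (X (r + h) - X r) =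
      ∫ s in r..t, S (t - s) (g (s + h) - g s) := by
    rw [duhamel_restart hS hle hc hg hX hr hrt,
      duhamel_restart hS hle hc hg hX (add_nonneg hr hh) (add_le_add_left hrt h), h1]
    simp_rw [map_sub]
    rw [intervalIntegral.integral_sub (intervalIntegrable_duhamel hle hc hgi' t)
      (intervalIntegrable_duhamel hle hc hgi t), add_sub_add_right_eq_sub]
    abel
  rw [h2]
  exact intervalIntegral.norm_integral_le_of_norm_le hrt (ae_of_all _ fun s hs =>
    (hle _ _).trans (hgb s (Ioc_subset_Icc_self hs))) hb

theorem IsContractionSemigroup.norm_sub_le_of_mem_graph (hS : IsContractionSemigroup S)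
    (hG : IsInfinitesimalGenerator S (-A)) (hle : ∀ t x, ‖S t x‖ ≤ ‖x‖) {x y : H}
    (h : (x, y) ∈ A.graph) {t : ℝ} (ht : 0 ≤ t) : ‖S t x - x‖ ≤ ‖y‖ * t := by
  have := norm_image_sub_le_of_norm_deriv_right_le_segment (a := 0) (b := t) (C := ‖y‖)
    ((hS.strongly_continuous x).mono Icc_subset_Ici_self)
    (fun s hs => hS.hasDerivWithinAt_orbit hG h hs.1)
    (fun s _ => by rw [norm_neg]; exact hle s y) t (right_mem_Icc.2 ht)
  simpa [hS.map_zero] using this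

/-- The integrand is uniformly close to `g t` for small `h`, by continuity of `(σ, s) ↦ S σ (g s)`
at `(0, t)`. -/
theorem tendsto_smul_integral_duhamel [CompleteSpace H] (h0 : S 0 = ContinuousLinearMap.id ℝ H)
    (hle : ∀ t x, ‖S t x‖ ≤ ‖x‖) (hc : Continuous fun p : ℝ × H => S p.1 p.2)
    (hg : ContinuousOn g (Ici 0)) {t : ℝ} (ht : 0 ≤ t) :
    Tendsto (fun h : ℝ => h⁻¹ • ∫ s in t..(t + h), S (t + h - s) (g s)) (𝓝[>] 0) (𝓝 (g t)) := by
  rw [Metric.tendsto_nhds]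
  intro ε hε
  have h1 : ContinuousWithinAt (fun p : ℝ × ℝ => S p.1 (g p.2)) (univ ×ˢ Ici 0) (0, t) :=
    hc.continuousAt.comp_continuousWithinAt (continuousWithinAt_fst.prodMk
      ((hg t ht).comp continuousWithinAt_snd fun p hp => hp.2))
  obtain ⟨δ, hδ, h2⟩ := Metric.continuousWithinAt_iff.1 h1 (ε / 2) (half_pos hε)
  filter_upwards [Ioo_mem_nhdsGT hδ] with h hh
  have hi : IntervalIntegrable (fun s => S (t + h - s) (g s)) volume t (t + h) :=
    intervalIntegrable_duhamel hle hc (ContinuousOn.intervalIntegrable (hg.mono (by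
      rw [uIcc_of_le (by linarith [hh.1])]; exact fun s hs => ht.trans hs.1))) _
  have h3 : ‖(∫ s in t..(t + h), S (t + h - s) (g s)) - h • g t‖ ≤ ε / 2 * h := by
    have h4 : h • g t = ∫ _ in t..(t + h), g t := by simp
    rw [h4, ← intervalIntegral.integral_sub hi intervalIntegrable_const]
    have h5 := intervalIntegral.norm_integral_le_of_norm_le_const (a := t) (b := t + h)
      (C := ε / 2) (f := fun s => S (t + h - s) (g s) - g t) fun s hs => by
        rw [uIoc_of_le (by linarith [hh.1])] at hs
        have h6 := h2 (x := (t + h - s, s)) ⟨mem_univ _, ht.trans hs.1.le⟩ (by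
          rw [Prod.dist_eq, Real.dist_eq, Real.dist_eq]
          exact max_lt (by rw [abs_lt]; constructor <;> linarith [hs.1, hs.2, hh.1, hh.2])
            (by rw [abs_lt]; constructor <;> linarith [hs.1, hs.2, hh.1, hh.2]))
        simp only [h0, ContinuousLinearMap.id_apply] at h6
        rw [← dist_eq_norm]
        exact h6.le
    simpa [abs_of_pos hh.1] using h5
  have h7 : (h⁻¹ • ∫ s in t..(t + h), S (t + h - s) (g s)) - g t =
      h⁻¹ • ((∫ s in t..(t + h), S (t + h - s) (g s)) - h • g t) := by
    rw [smul_sub, inv_smul_smul₀ hh.1.ne']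
  rw [dist_eq_norm, h7, norm_smul, norm_inv, Real.norm_of_nonneg hh.1.le,
    inv_mul_lt_iff₀ hh.1]
  nlinarith [mul_pos hε hh.1, hh.1]

/-- A Lipschitz mild solution takes its values in `D(A)` and satisfies the equation with right
derivatives. -/
theorem duhamel_hasDerivWithinAt_Ici [CompleteSpace H] (hA : IsMaximalMonotone A)
    (hS : IsContractionSemigroup S)
    (hG : IsInfinitesimalGenerator S (-A)) (hle : ∀ t x, ‖S t x‖ ≤ ‖x‖)
    (hc : Continuous fun p : ℝ × H => S p.1 p.2) (hg : ContinuousOn g (Ici 0))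
    (hX : ∀ t, 0 ≤ t → X t = S t X₀ + ∫ s in (0 : ℝ)..t, S (t - s) (g s)) {t C : ℝ} (ht : 0 ≤ t)
    (hC : ∀ᶠ h in 𝓝[>] (0 : ℝ), ‖X (t + h) - X t‖ ≤ C * h) :
    ∃ y, (X t, y) ∈ A.graph ∧ HasDerivWithinAt X (g t - y) (Ici t) t := by
  have hlim := tendsto_smul_integral_duhamel hS.map_zero hle hc hg ht
  have heq : ∀ h : ℝ, 0 < h → X (t + h) - X t =
      (S h (X t) - X t) + ∫ s in t..(t + h), S (t + h - s) (g s) := fun h hh => by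
    rw [duhamel_restart hS hle hc hg hX ht (le_add_of_nonneg_right hh.le), add_sub_cancel_left]
    abel
  have hdom : X t ∈ A.domain := by
    refine hA.mem_domain_of_norm_sub_le hle hG (C := C + (‖g t‖ + 1)) ?_
    filter_upwards [hC, self_mem_nhdsWithin,
      hlim.norm.eventually (gt_mem_nhds (lt_add_one ‖g t‖))] with h h1 h2 h3
    have h2 : 0 < h := h2
    rw [norm_smul, norm_inv, Real.norm_of_nonneg h2.le, inv_mul_lt_iff₀ h2] at h3
    have h4 : S h (X t) - X t =
      (X (t + h) - X t) - ∫ s in t..(t + h), S (t + h - s) (g s) := by rw [heq h h2]; abel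
    rw [h4]
    refine (norm_sub_le _ _).trans ?_
    linarith
  obtain ⟨y, hy⟩ := LinearPMap.mem_domain_iff.1 hdom
  refine ⟨y, hy, hasDerivWithinAt_Ici_iff_tendsto.2 ?_⟩
  have h5 := (hG.tendsto_slope hy).add hlim
  rw [neg_add_eq_sub] at h5
  refine h5.congr' ?_
  filter_upwards [self_mem_nhdsWithin] with h hh
  rw [heq h hh, smul_add]

theorem continuousOn_of_norm_sub_semigroup_le (hc : Continuous fun p : ℝ × H => S p.1 p.2)
    {w : ℝ → H} {L : ℝ} (hL : 0 ≤ L)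
    (hw : ∀ r t, 0 ≤ r → r ≤ t → t ≤ T → ‖w t - S (t - r) (w r)‖ ≤ L * (t - r)) :
    ContinuousOn w (Icc 0 T) := by
  intro t₀ ht₀
  rw [Metric.continuousWithinAt_iff]
  intro ε hε
  obtain ⟨δ, hδ, hδL⟩ : ∃ δ, 0 < δ ∧ L * δ < ε / 6 :=
    ⟨ε / (12 * (L + 1)), by positivity, by
      rw [mul_div_assoc', div_lt_div_iff₀ (by positivity) (by positivity)]
      nlinarith⟩
  -- Orbits only run forward, so the comparison orbit starts slightly before `t₀` and covers both
  -- sides of it.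
  set r := max (t₀ - δ) 0 with hr
  have hr0 : 0 ≤ r := le_max_right _ _
  have hrt : r ≤ t₀ := max_le (by linarith) ht₀.1
  have hrδ : t₀ - δ ≤ r := le_max_left _ _
  have hv : Continuous fun t => S (t - r) (w r) :=
    hc.comp ((continuous_id.sub continuous_const).prodMk continuous_const)
  obtain ⟨η, hη, hv'⟩ := Metric.continuousAt_iff.1 (hv.continuousAt (x := t₀)) (ε / 3)
    (by positivity)
  refine ⟨min η δ, lt_min hη hδ, fun {t} ht htd => ?_⟩
  have h1 := hv' (htd.trans_le (min_le_left _ _))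
  have h2 := abs_lt.1 (htd.trans_le (min_le_right η δ))
  have h3 : r ≤ t := max_le (by linarith) ht.1
  have h4 := hw r t hr0 h3 ht.2
  have h5 := hw r t₀ hr0 hrt ht₀.2
  have h6 : L * (t - r) ≤ L * (2 * δ) := mul_le_mul_of_nonneg_left (by linarith) hL
  have h7 : L * (t₀ - r) ≤ L * δ := mul_le_mul_of_nonneg_left (by linarith) hL
  rw [dist_eq_norm] at h1 ⊢
  have h8 : w t - w t₀ = (w t - S (t - r) (w r)) + (S (t - r) (w r) - S (t₀ - r) (w r)) -
      (w t₀ - S (t₀ - r) (w r)) := by abel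
  rw [h8]
  linarith [norm_sub_le ((w t - S (t - r) (w r)) + (S (t - r) (w r) - S (t₀ - r) (w r)))
    (w t₀ - S (t₀ - r) (w r)),
    norm_add_le (w t - S (t - r) (w r)) (S (t - r) (w r) - S (t₀ - r) (w r))]

/-- A continuous function with a continuous right derivative is differentiable. -/
theorem hasDerivWithinAt_Icc_of_right [CompleteSpace H] (hT : 0 ≤ T) {w : ℝ → H}
    (hX : ContinuousOn X (Icc 0 T))
    (hd : ∀ t ∈ Ico 0 T, HasDerivWithinAt X (w t) (Ici t) t) (hw : ContinuousOn w (Icc 0 T))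
    {t : ℝ} (ht : t ∈ Icc 0 T) : HasDerivWithinAt X (w t) (Icc 0 T) t := by
  have hc : Continuous (IccExtend hT ((Icc 0 T).domRestrict w)) := hw.domRestrict.Icc_extend'
  set ψ := IccExtend hT ((Icc 0 T).domRestrict w)
  have hψ : ∀ s ∈ Icc 0 T, ψ s = w s := fun s hs => IccExtend_of_mem _ _ hs
  have hd' : ∀ t, HasDerivAt (fun t => X 0 + ∫ s in (0 : ℝ)..t, ψ s) (ψ t) t := fun t =>
    (intervalIntegral.integral_hasDerivAt_right (hc.intervalIntegrable _ _)
      (hc.stronglyMeasurableAtFilter _ _) hc.continuousAt).const_add _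
  have heq := eq_of_has_deriv_right_eq hd
    (fun s hs => by
      rw [← hψ s (Ico_subset_Icc_self hs)]
      exact (hd' s).hasDerivWithinAt) hX
    (fun s _ => (hd' s).continuousAt.continuousWithinAt) (by simp)
  rw [← hψ t ht]
  exact (hd' t).hasDerivWithinAt.congr heq (heq t ht)

end Regularity

/-! ### Classical solutions for Lipschitz data. -/

section Classical

variable {H : Type*} [NormedAddCommGroup H] [InnerProductSpace ℝ H] {A : H →ₗ.[ℝ] H}
  {S : ℝ → H →L[ℝ] H} {f : ℝ → H →L[ℝ] H} {d X : ℝ → H} {X₀ : H}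

theorem LipschitzOnWith.norm_add_sub_le {E : Type*} [NormedAddCommGroup E] {u : ℝ → E} {K : NNReal}
    (hu : LipschitzOnWith K u (Ici 0)) {t h : ℝ} (ht : 0 ≤ t) (hh : 0 ≤ h) :
    ‖u (t + h) - u t‖ ≤ K * h := by
  have := hu.norm_sub_le (mem_Ici.2 (add_nonneg ht hh)) (mem_Ici.2 ht)
  rwa [add_sub_cancel_left, Real.norm_of_nonneg hh] at this

theorem duhamel_lipschitz [CompleteSpace H] (hS : IsContractionSemigroup S)
    (hG : IsInfinitesimalGenerator S (-A)) (hle : ∀ t x, ‖S t x‖ ≤ ‖x‖)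
    (hc : Continuous fun p : ℝ × H => S p.1 p.2) {Kf Kd : NNReal}
    (hf : LipschitzOnWith Kf f (Ici 0)) (hd : LipschitzOnWith Kd d (Ici 0))
    (hXc : ContinuousOn X (Ici 0)) (hX₀ : X₀ ∈ A.domain)
    (hX : ∀ t, 0 ≤ t → X t = S t X₀ + ∫ s in (0 : ℝ)..t, S (t - s) (f s (X s) + d s)) {T : ℝ}
    (hT : 0 ≤ T) :
    ∃ C L : ℝ, 0 ≤ L ∧ ∀ t ∈ Icc 0 T, ∀ h ∈ Icc (0 : ℝ) 1, ‖X (t + h) - X t‖ ≤ C * h ∧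
      ‖(f (t + h) (X (t + h)) + d (t + h)) - (f t (X t) + d t)‖ ≤ L * h := by
  obtain ⟨y, hy⟩ := LinearPMap.mem_domain_iff.1 hX₀
  have hg : ContinuousOn (fun s => f s (X s) + d s) (Ici 0) :=
    (hf.continuousOn.clm_apply hXc).add hd.continuousOn
  -- The extra unit of time leaves room for shifts `h ≤ 1`.
  have hsub : Icc 0 (T + 1) ⊆ Ici (0 : ℝ) := Icc_subset_Ici_self
  obtain ⟨R, hR⟩ := isCompact_Icc.exists_bound_of_continuousOn (hXc.mono hsub)
  obtain ⟨M, hM⟩ := isCompact_Icc.exists_bound_of_continuousOn (hf.continuousOn.mono hsub)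
  obtain ⟨G, hG'⟩ := isCompact_Icc.exists_bound_of_continuousOn (hg.mono hsub)
  have h0T : (0 : ℝ) ∈ Icc 0 (T + 1) := ⟨le_rfl, by linarith⟩
  have hR0 : 0 ≤ R := (norm_nonneg _).trans (hR 0 h0T)
  have hM0 : 0 ≤ M := (norm_nonneg _).trans (hM 0 h0T)
  have hG0 : 0 ≤ G := (norm_nonneg _).trans (hG' 0 h0T)
  have hstep : ∀ t ∈ Icc 0 T, ∀ h ∈ Icc (0 : ℝ) 1,
      ‖(f (t + h) (X (t + h)) + d (t + h)) - (f t (X t) + d t)‖ ≤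
        M * ‖X (t + h) - X t‖ + (Kf * R + Kd) * h := fun t ht h hh => by
    have h1 : (f (t + h) (X (t + h)) + d (t + h)) - (f t (X t) + d t) =
        f (t + h) (X (t + h) - X t) + (f (t + h) - f t) (X t) + (d (t + h) - d t) := by
      rw [map_sub, sub_apply]; abel
    have h2 := (f (t + h)).le_of_opNorm_le
      (hM (t + h) ⟨add_nonneg ht.1 hh.1, add_le_add ht.2 hh.2⟩) (X (t + h) - X t)
    have h3 := (f (t + h) - f t).le_of_opNorm_le_of_le (hf.norm_add_sub_le ht.1 hh.1)
      (hR t ⟨ht.1, ht.2.trans (by linarith)⟩)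
    have h4 := hd.norm_add_sub_le ht.1 hh.1
    rw [h1]
    refine (norm_add₃_le).trans ?_
    linarith
  have hmain : ∀ t ∈ Icc 0 T, ∀ h ∈ Icc (0 : ℝ) 1, ‖X (t + h) - X t‖ ≤
      (‖y‖ + G + (Kf * R + Kd) * T) * Real.exp (M * T) * h := fun t ht h hh => by
    have hφ : ContinuousOn (fun t => ‖X (t + h) - X t‖) (Icc 0 T) :=
      ((hXc.comp (by fun_prop) fun s hs => add_nonneg hs.1 hh.1).sub
        (hXc.mono Icc_subset_Ici_self)).norm
    -- The only place where `X₀ ∈ D(A)` enters: `‖y‖` bounds the speed of the orbit of `X₀`, and `G`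
    -- bounds the forcing.
    have hinit : ‖X h - X 0‖ ≤ (‖y‖ + G) * h := by
      have h1 : X 0 = X₀ := by simp [hX 0 le_rfl, hS.map_zero]
      have h2 := hS.norm_sub_le_of_mem_graph hG hle hy hh.1
      have h3 : ‖∫ s in (0 : ℝ)..h, S (h - s) (f s (X s) + d s)‖ ≤ G * |h - 0| :=
        intervalIntegral.norm_integral_le_of_norm_le_const fun s hs => by
          rw [uIoc_of_le hh.1] at hs
          exact (hle _ _).trans (hG' s ⟨hs.1.le, by linarith [hs.2, hh.2]⟩)
      rw [sub_zero, abs_of_nonneg hh.1] at h3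
      rw [h1, hX h hh.1, add_sub_right_comm]
      refine (norm_add_le _ _).trans ?_
      linarith
    have hgr := le_mul_exp_of_le_add_mul_integral (a := (‖y‖ + G + (Kf * R + Kd) * T) * h) hφ hM0
      (fun t ht => by
        have hφt : IntervalIntegrable (fun s => ‖X (s + h) - X s‖) volume 0 t :=
          ContinuousOn.intervalIntegrable (hφ.mono (by
            rw [uIcc_of_le ht.1]; exact Icc_subset_Icc_right ht.2))
        have h1 := norm_duhamel_shift_sub_le hS hle hc hg hX le_rfl ht.1 hh.1
          (b := fun s => M * ‖X (s + h) - X s‖ + (Kf * R + Kd) * h)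
          ((hφt.const_mul M).add intervalIntegrable_const)
          (fun s hs => hstep s ⟨hs.1, hs.2.trans ht.2⟩ h hh)
        rw [intervalIntegral.integral_add (hφt.const_mul M) intervalIntegrable_const,
          intervalIntegral.integral_const_mul, intervalIntegral.integral_const, sub_zero,
          smul_eq_mul, zero_add] at h1
        have h2 := norm_le_norm_add_norm_sub' (X (t + h) - X t) (S t (X h - X 0))
        have h3 := (hle t (X h - X 0)).trans hinit
        have h4 : t * ((Kf * R + Kd) * h) ≤ T * ((Kf * R + Kd) * h) :=
          mul_le_mul_of_nonneg_right ht.2 (mul_nonneg (by positivity) hh.1)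
        linarith) ht
    refine hgr.trans ?_
    have h5 : Real.exp (M * t) ≤ Real.exp (M * T) :=
      Real.exp_le_exp.2 (mul_le_mul_of_nonneg_left ht.2 hM0)
    have h6 : 0 ≤ (‖y‖ + G + (Kf * R + Kd) * T) * h := mul_nonneg (by positivity) hh.1
    refine (mul_le_mul_of_nonneg_left h5 h6).trans_eq (by ring)
  refine ⟨_, M * ((‖y‖ + G + (Kf * R + Kd) * T) * Real.exp (M * T)) + (Kf * R + Kd),
    by positivity, fun t ht h hh => ⟨hmain t ht h hh, (hstep t ht h hh).trans ?_⟩⟩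
  have := mul_le_mul_of_nonneg_left (hmain t ht h hh) hM0
  linarith

theorem duhamel_isClassicalSolution [CompleteSpace H] (hA : IsMaximalMonotone A)
    (hS : IsContractionSemigroup S)
    (hG : IsInfinitesimalGenerator S (-A)) (hle : ∀ t x, ‖S t x‖ ≤ ‖x‖)
    (hc : Continuous fun p : ℝ × H => S p.1 p.2) {Kf Kd : NNReal}
    (hf : LipschitzOnWith Kf f (Ici 0)) (hd : LipschitzOnWith Kd d (Ici 0))
    (hXc : ContinuousOn X (Ici 0)) (hX₀ : X₀ ∈ A.domain)
    (hX : ∀ t, 0 ≤ t → X t = S t X₀ + ∫ s in (0 : ℝ)..t, S (t - s) (f s (X s) + d s)) {T : ℝ}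
    (hT : 0 < T) : IsClassicalSolution A f d X₀ T X := by
  obtain ⟨C, L, hL, hCL⟩ := duhamel_lipschitz hS hG hle hc hf hd hXc hX₀ hX hT.le
  have hg : ContinuousOn (fun s => f s (X s) + d s) (Ici 0) :=
    (hf.continuousOn.clm_apply hXc).add hd.continuousOn
  have hsub : Icc 0 T ⊆ Ici (0 : ℝ) := Icc_subset_Ici_self
  have h01 : ∀ᶠ h in 𝓝[>] (0 : ℝ), h ∈ Icc (0 : ℝ) 1 :=
    mem_of_superset (Ioo_mem_nhdsGT one_pos) Ioo_subset_Icc_self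
  have hex : ∀ t ∈ Icc 0 T, ∃ y, (X t, y) ∈ A.graph ∧
      HasDerivWithinAt X (f t (X t) + d t - y) (Ici t) t := fun t ht =>
    duhamel_hasDerivWithinAt_Ici hA hS hG hle hc hg hX ht.1
      (h01.mono fun h hh => (hCL t ht h hh).1)
  choose! y hy hder using hex
  -- The shift estimate divided by `h`, in the limit `h → 0⁺`: the right derivative follows
  -- semigroup orbits up to a Lipschitz error.
  have hwS : ∀ r t, 0 ≤ r → r ≤ t → t ≤ T → ‖(f t (X t) + d t - y t) -
      S (t - r) (f r (X r) + d r - y r)‖ ≤ L * (t - r) := fun r t hr hrt htT => by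
    have h1 := hasDerivWithinAt_Ici_iff_tendsto.1 (hder t ⟨hr.trans hrt, htT⟩)
    have h2 := hasDerivWithinAt_Ici_iff_tendsto.1 (hder r ⟨hr, hrt.trans htT⟩)
    refine le_of_tendsto (h1.sub (((S (t - r)).continuous.tendsto _).comp h2)).norm ?_
    filter_upwards [h01, self_mem_nhdsWithin] with h hh hh0
    have hh0 : 0 < h := hh0
    have h3 := norm_duhamel_shift_sub_le hS hle hc hg hX hr hrt hh.1 (b := fun _ => L * h)
      intervalIntegrable_const fun s hs => (hCL s ⟨hr.trans hs.1, hs.2.trans htT⟩ h hh).2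
    rw [intervalIntegral.integral_const, smul_eq_mul] at h3
    rw [Function.comp_apply, map_smul, ← smul_sub, norm_smul, norm_inv,
      Real.norm_of_nonneg hh.1, inv_mul_le_iff₀ hh0]
    linarith
  have hwc := continuousOn_of_norm_sub_semigroup_le hc hL hwS
  have hd' : ∀ t ∈ Icc 0 T, derivWithin X (Icc 0 T) t = f t (X t) + d t - y t := fun t ht =>
    (hasDerivWithinAt_Icc_of_right hT.le (hXc.mono hsub)
      (fun s hs => hder s (Ico_subset_Icc_self hs)) hwc ht).derivWithin (uniqueDiffOn_Icc hT t ht)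
  have hAy : ∀ t (ht : t ∈ Icc 0 T) (hD : X t ∈ A.domain), A ⟨X t, hD⟩ = y t := fun t ht hD =>
    LinearPMap.mem_graph_snd_inj' A (A.mem_graph ⟨X t, hD⟩) (hy t ht) rfl
  refine ⟨by simp [hX 0 le_rfl, hS.map_zero],
    (contDiffOn_one_iff_derivWithin (uniqueDiffOn_Icc hT)).2 ⟨fun t ht =>
      (hasDerivWithinAt_Icc_of_right hT.le (hXc.mono hsub)
        (fun s hs => hder s (Ico_subset_Icc_self hs)) hwc ht).differentiableWithinAt,
      hwc.congr hd'⟩,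
    fun t => LinearPMap.mem_domain_of_mem_graph (hy t t.2), ?_, fun t => ?_⟩
  · simp_rw [fun t : Icc 0 T => hAy t t.2]
    have hyc : ContinuousOn y (Icc 0 T) :=
      ((hg.mono hsub).sub hwc).congr fun t _ => by simp
    exact (hXc.mono hsub).domRestrict.prodMk hyc.domRestrict
  · rw [hd' t t.2, hAy t t.2, sub_add_cancel]

end Classical

/-! ### Gluing the solutions over all horizons. -/

theorem theorem1 {H : Type*} [NormedAddCommGroup H] [InnerProductSpace ℝ H] [CompleteSpace H]
    (A : H →ₗ.[ℝ] H) (hA : IsMaximalMonotone A)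
    (f : ℝ → H →L[ℝ] H) (hf : ∀ T : ℝ, 0 < T → MemLp f ⊤ (volume.restrict (Icc 0 T)))
    (d : ℝ → H) (hd : ∀ T : ℝ, 0 < T → IntegrableOn d (Icc 0 T)) :
    closure (A.domain : Set H) = univ ∧
    ∀ X₀ : H, ∃ X : ℝ → H,
      (∀ T : ℝ, 0 < T →
        IsMildSolution A f d X₀ T X ∧
        ∀ Y : ℝ → H, IsMildSolution A f d X₀ T Y → EqOn Y X (Icc 0 T)) ∧
      ((∃ K, LipschitzOnWith K f (Ici 0)) → (∃ K, LipschitzOnWith K d (Ici 0)) →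
        X₀ ∈ A.domain → ∀ T : ℝ, 0 < T → IsClassicalSolution A f d X₀ T X) := by
  refine ⟨hA.dense_domain.closure_eq, fun X₀ => ?_⟩
  obtain ⟨S, hS, hG, hle, hc⟩ := hA.exists_semigroup
  choose! Z hZc hZd using fun (T : ℝ) (hT : 0 < T) =>
    duhamel_exists (f := f) (d := d) hle hc hT.le (hf T hT) (hd T hT) X₀
  have hZu : ∀ a b, 0 < a → a ≤ b → EqOn (Z a) (Z b) (Icc 0 a) := fun a b ha hab =>
    have hsub : Icc 0 a ⊆ Icc 0 b := Icc_subset_Icc_right hab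
    duhamel_unique hle hc (hf a ha) (hd a ha) (hZc a ha) ((hZc b (ha.trans_le hab)).mono hsub)
      (hZd a ha) fun t ht => hZd b (ha.trans_le hab) t (hsub ht)
  -- The horizon `|t| + 1` is always positive and exceeds `t`; by uniqueness the choice of horizon
  -- is immaterial.
  let X : ℝ → H := fun t => Z (|t| + 1) t
  have hXZ : ∀ T, 0 < T → EqOn X (Z T) (Icc 0 T) := fun T hT t ht => by
    have h1 : 0 < |t| + 1 := by positivity
    have h2 : t ∈ Icc 0 (|t| + 1) := ⟨ht.1, by linarith [le_abs_self t]⟩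
    rcases le_total (|t| + 1) T with h | h
    · exact hZu _ _ h1 h h2
    · exact (hZu _ _ hT h ht).symm
  have hXcT : ∀ T, 0 < T → ContinuousOn X (Icc 0 T) := fun T hT => (hZc T hT).congr (hXZ T hT)
  have hX : ∀ t, 0 ≤ t → X t = S t X₀ + ∫ s in (0 : ℝ)..t, S (t - s) (f s (X s) + d s) :=
    fun t ht => by
      have h1 : 0 < t + 1 := by linarith
      rw [hXZ _ h1 ⟨ht, by linarith⟩, hZd _ h1 t ⟨ht, by linarith⟩]
      congr 1
      refine intervalIntegral.integral_congr fun s hs => ?_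
      rw [uIcc_of_le ht] at hs
      simp only [hXZ _ h1 ⟨hs.1, hs.2.trans (by linarith)⟩]
  refine ⟨X, fun T hT => ⟨⟨hXcT T hT, S, hS, hG, fun t ht =>
    ⟨intervalIntegrable_duhamel hle hc
      (intervalIntegrable_forcing (hf T hT) (hd T hT) (hXcT T hT) ht) t, hX t ht.1⟩⟩,
    fun Y hY => ?_⟩, ?_⟩
  · obtain ⟨hYc, S', hS', hG', hYd⟩ := hY
    refine duhamel_unique hle hc (hf T hT) (hd T hT) hYc (hXcT T hT) (fun t ht => ?_)
      fun t ht => hX t ht.1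
    -- A competing mild solution carries its own semigroup, which must first be identified with `S`.
    rw [(hYd t ht).2, hS'.eq_of_generator hA hS hG' hG ht.1]
    congr 1
    refine intervalIntegral.integral_congr fun s hs => ?_
    rw [uIcc_of_le ht.1] at hs
    simp only [hS'.eq_of_generator hA hS hG' hG (sub_nonneg.2 hs.2)]
  · rintro ⟨Kf, hKf⟩ ⟨Kd, hKd⟩ hX₀ T hT
    refine duhamel_isClassicalSolution hA hS hG hle hc hKf hKd (fun t ht => ?_) hX₀ hX hT
    have ht : 0 ≤ t := ht
    refine (hXcT (t + 1) (by linarith) t ⟨ht, by linarith⟩).mono_of_mem_nhdsWithin ?_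
    rw [← Ici_inter_Iic]
    exact inter_mem_nhdsWithin _ (Iic_mem_nhds (by linarith))
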